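/- Let $d\in\mathbb N$, $\eta>0$, $0<\mu_f\le L_f$, $0<\mu_\phi\le L_\phi$. For $0\le\mu\le L$ let $S(\mu,L)$ be the set of continuously differentiable $h:\mathbb R^d\to\mathbb R$ with $\mu\|x-y\|^2\le(\nabla h(x)-\nabla h(y))^T(x-y)\le L\|x-y\|^2$ for all $x,y$. Let $f\in S(\mu_f,L_f)$, $\phi\in S(\mu_\phi,L_\phi)$, let $\bar\phi(z)=\sup_x\{x^Tz-\phi(x)\}$ be the convex conjugate of $\phi$, and put $\mu_{\bar\phi}=1/L_\phi$. Then $f$ has a unique minimizer $x^{\rm opt}$, and the continuous-time mirror descent flow $\dot z=-\eta\,\nabla f(\nabla\bar\phi(z))$ has a unique equilibrium $z^{\rm opt}$, with $\nabla\bar\phi(z^{\rm opt})=x^{\rm opt}$. Let $G$ be the causal linear time-invariant operator with transfer function $$G(s)=\frac{1}{s+\eta\mu_f\mu_{\bar\phi}}\begin{bmatrix}-\eta\mu_{\bar\phi}&s\\-\eta&-\eta\mu_f\end{bmatrix}\otimes I_d ,$$ and let $\Delta$ be the nonlinearity $\Delta(v)=(\Delta_1(v_1),\Delta_2(v_2))$,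 acting pointwise in time on signals $v=(v_1,v_2)$ with values in $\mathbb R^d\times\mathbb R^d$, where $$\Delta_1(x)=\big(\nabla f(x+x^{\rm opt})-\mu_f(x+x^{\rm opt})\big)-\big(\nabla f(x^{\rm opt})-\mu_fx^{\rm opt}\big),$$ $$\Delta_2(x)=\big(\nabla\bar\phi(x+z^{\rm opt})-\mu_{\bar\phi}(x+z^{\rm opt})\big)-\big(\nabla\bar\phi(z^{\rm opt})-\mu_{\bar\phi}z^{\rm opt}\big).$$ Let $\mathbf L_{2e}[0,\infty)$ be the space of signals that are square integrable on finite intervals. (1) The interconnection $v=Gw+g$, $w=\Delta(v)+e$ is stable: $G$ and $\Delta$ are causal operators on $\mathbf L_{2e}[0,\infty)$, the map $(v,w)\mapsto(e,g)$ has a causal inverse on $\mathbf L_{2e}[0,\infty)$, and there is a constant $c>0$ with $\int_0^T(|v|^2+|w|^2)\,dt\le c\int_0^T(|g|^2+|e|^2)\,dt$ for all $T\ge0$ and all $e,g\in\mathbf L_{2e}[0,\infty)$. In particular $v,w\in\mathbf L_2[0,\infty)$ whenever $e,g\in\mathbf L_2[0,\infty)$. (2) For every $z_0\in\mathbb R^d$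 the flow has a solution on $[0,\infty)$ with $z(0)=z_0$, and along every solution $x(t)=\nabla\bar\phi(z(t))\to x^{\rm opt}$ as $t\to\infty$. -/

import Mathlib

open MeasureTheory Set Filter Topology

noncomputable section

namespace MirrorDescent

/-- The Euclidean space `ℝ^d`. -/
abbrev Vec (d : ℕ) : Type := EuclideanSpace ℝ (Fin d)

/-- The space `ℝ^d × ℝ^d = ℝ^(2d)` of stacked vectors, with the Euclidean norm. -/
abbrev Vec2 (d : ℕ) : Type := EuclideanSpace ℝ (Fin d ⊕ Fin d)

/-- Upper half of a stacked vector. -/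
def upper {d : ℕ} (v : Vec2 d) : Vec d := WithLp.toLp 2 (fun i => v (Sum.inl i))

/-- Lower half of a stacked vector. -/
def lower {d : ℕ} (v : Vec2 d) : Vec d := WithLp.toLp 2 (fun i => v (Sum.inr i))

/-- The stacked vector with upper half `a` and lower half `b`. -/
def stack {d : ℕ} (a b : Vec d) : Vec2 d := WithLp.toLp 2 (Sum.elim a b)

/-! ### Functions -/

/-- The class `S(μ, L)`: continuously differentiable, `μ`-strongly convex, `L`-smooth functions. -/
def classS {d : ℕ} (μ L : ℝ) : Set (Vec d → ℝ) :=
  {f | ContDiff ℝ 1 f ∧ ∀ x y : Vec d,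
    μ * ‖x - y‖ ^ 2 ≤ inner ℝ (gradient f x - gradient f y) (x - y) ∧
    inner ℝ (gradient f x - gradient f y) (x - y) ≤ L * ‖x - y‖ ^ 2}

/-- The convex conjugate `z ↦ sup_x (xᵀ z - φ x)`. -/
def conjugate {d : ℕ} (φ : Vec d → ℝ) (z : Vec d) : ℝ :=
  ⨆ x : Vec d, (inner ℝ x z - φ x)

/-! ### Signals and feedback interconnections

A signal on `[0, ∞)` is represented by a function on `ℝ`, of which only the values at `t ≥ 0`
matter; signals are identified when they agree almost everywhere. -/

/-- The space `L₂[0, ∞)`. -/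
def L2 (E : Type*) [NormedAddCommGroup E] : Set (ℝ → E) :=
  {u | MemLp u 2 (volume.restrict (Ici 0))}

/-- The extended space `L₂ₑ[0, ∞)`: signals that are square integrable on finite intervals. -/
def L2e (E : Type*) [NormedAddCommGroup E] : Set (ℝ → E) :=
  {u | ∀ T : ℝ, MemLp u 2 (volume.restrict (Icc 0 T))}

/-- Two signals agree almost everywhere on `[0, T]`, i.e. `P_T u = P_T u'`. -/
def AgreeUpTo {E : Type*} (T : ℝ) (u u' : ℝ → E) : Prop :=
  u =ᵐ[volume.restrict (Icc 0 T)] u'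

/-- `H` is a causal operator on `L₂ₑ`. The second clause is equivalent to
`P_T H P_T = P_T H` for operators on classes of almost everywhere equal signals; it also says
that `H` is well defined on these classes. -/
def IsCausal {E F : Type*} [NormedAddCommGroup E] [NormedAddCommGroup F]
    (H : (ℝ → E) → (ℝ → F)) : Prop :=
  (∀ u ∈ L2e E, H u ∈ L2e F) ∧
  ∀ T : ℝ, 0 ≤ T → ∀ u ∈ L2e E, ∀ u' ∈ L2e E, AgreeUpTo T u u' → AgreeUpTo T (H u) (H u')

/-- The interconnection equations `v = G w + g`, `w = Δ v + e` (almost everywhere on `[0, ∞)`),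
for signals in `L₂ₑ`. -/
structure Interconnected {E F : Type*} [NormedAddCommGroup E] [NormedAddCommGroup F]
    (G : (ℝ → F) → (ℝ → E)) (Δ : (ℝ → E) → (ℝ → F))
    (e : ℝ → F) (g : ℝ → E) (v : ℝ → E) (w : ℝ → F) : Prop where
  mem_v : v ∈ L2e E
  mem_w : w ∈ L2e F
  eq_v : v =ᵐ[volume.restrict (Ici 0)] G w + g
  eq_w : w =ᵐ[volume.restrict (Ici 0)] Δ v + e

/-- Well-posedness of the interconnection of the causal operators `G` and `Δ`: the map
`(v, w) ↦ (e, g)` has a causal inverse on `L₂ₑ`. The last clause, for all `T`, contains the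
uniqueness of `(v, w)` for given `(e, g)` as well as the causality of the inverse. -/
structure WellPosed {E F : Type*} [NormedAddCommGroup E] [NormedAddCommGroup F]
    (G : (ℝ → F) → (ℝ → E)) (Δ : (ℝ → E) → (ℝ → F)) : Prop where
  causal_G : IsCausal G
  causal_Δ : IsCausal Δ
  exists_solution : ∀ e ∈ L2e F, ∀ g ∈ L2e E, ∃ v w, Interconnected G Δ e g v w
  causal_inverse : ∀ T : ℝ, 0 ≤ T → ∀ e ∈ L2e F, ∀ e' ∈ L2e F, ∀ g ∈ L2e E, ∀ g' ∈ L2e E,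
    ∀ v w v' w', Interconnected G Δ e g v w → Interconnected G Δ e' g' v' w' →
    AgreeUpTo T e e' → AgreeUpTo T g g' → AgreeUpTo T v v' ∧ AgreeUpTo T w w'

/-- Stability of the interconnection: it is well-posed and the inverse is bounded. -/
def IsStable {E F : Type*} [NormedAddCommGroup E] [NormedAddCommGroup F]
    (G : (ℝ → F) → (ℝ → E)) (Δ : (ℝ → E) → (ℝ → F)) : Prop :=
  WellPosed G Δ ∧
  ∃ c : ℝ, 0 < c ∧ ∀ e ∈ L2e F, ∀ g ∈ L2e E, ∀ v w, Interconnected G Δ e g v w →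
    ∀ T : ℝ, 0 ≤ T →
      ∫ t in (0 : ℝ)..T, (‖v t‖ ^ 2 + ‖w t‖ ^ 2) ≤
        c * ∫ t in (0 : ℝ)..T, (‖g t‖ ^ 2 + ‖e t‖ ^ 2)

/-! ### Linear time-invariant systems -/

section LTI

variable {n m l : Type*} [Fintype n] [DecidableEq n] [Fintype m] [Fintype l]

/-- The transfer function matrix `C (s I - A)⁻¹ B + D`. -/
def transferFunction (A : Matrix n n ℝ) (B : Matrix n m ℝ) (C : Matrix l n ℝ)
    (D : Matrix l m ℝ) (s : ℂ) : Matrix l m ℂ :=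
  C.map Complex.ofReal * (s • (1 : Matrix n n ℂ) - A.map Complex.ofReal)⁻¹ *
    B.map Complex.ofReal + D.map Complex.ofReal

/-- The input-output operator with the transfer function `C (s I - A)⁻¹ B + D`:
`(G w)(t) = ∫₀ᵗ C exp((t - s) A) B w(s) ds + D w(t)`, the output of `ż = A z + B w`,
`y = C z + D w` with zero initial state. -/
def ltiOperator (A : Matrix n n ℝ) (B : Matrix n m ℝ) (C : Matrix l n ℝ) (D : Matrix l m ℝ)
    (w : ℝ → EuclideanSpace ℝ m) (t : ℝ) : EuclideanSpace ℝ l :=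
  WithLp.toLp 2 ((∫ s in (0 : ℝ)..t,
      (C * NormedSpace.exp ((t - s) • A) * B).mulVec (w s).ofLp) + D.mulVec (w t).ofLp)

end LTI

/-! ### The mirror descent system -/

section System

variable (d : ℕ) (η μf μc : ℝ)

/-- System matrix `A`; `μc` is the strong convexity constant of the conjugate of `φ`. -/
def matA : Matrix (Fin d) (Fin d) ℝ := (-(η * μf * μc)) • 1

/-- System matrix `B = [-η I, -η μf I]`. -/
def matB : Matrix (Fin d) (Fin d ⊕ Fin d) ℝ := Matrix.fromCols ((-η) • 1) ((-(η * μf)) • 1)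

/-- System matrix `C = [μc I; I]`. -/
def matC : Matrix (Fin d ⊕ Fin d) (Fin d) ℝ := Matrix.fromRows (μc • 1) 1

/-- System matrix `D = [0, I; 0, 0]`. -/
def matD : Matrix (Fin d ⊕ Fin d) (Fin d ⊕ Fin d) ℝ := Matrix.fromBlocks 0 1 0 0

/-- The linear operator `G` of the mirror descent system. -/
def mdOperator : (ℝ → Vec2 d) → (ℝ → Vec2 d) :=
  ltiOperator (matA d η μf μc) (matB d η μf) (matC d μc) (matD d)

/-- The transfer function matrix of `mdOperator` is
`(s + η μf μc)⁻¹ [-η μc, s; -η, -η μf] ⊗ I_d`. -/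
theorem transferFunction_md (s : ℂ) (hs : s + η * μf * μc ≠ 0) :
    transferFunction (matA d η μf μc) (matB d η μf) (matC d μc) (matD d) s =
      (s + η * μf * μc)⁻¹ • Matrix.fromBlocks ((-(η * μc) : ℂ) • 1) (s • 1)
        ((-η : ℂ) • 1) ((-(η * μf) : ℂ) • 1) := by
  have hinv : (s • (1 : Matrix (Fin d) (Fin d) ℂ) - (matA d η μf μc).map Complex.ofReal)⁻¹
      = (s + η * μf * μc)⁻¹ • (1 : Matrix (Fin d) (Fin d) ℂ) := by
    apply Matrix.inv_eq_left_inv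
    have : (s • (1 : Matrix (Fin d) (Fin d) ℂ) - (matA d η μf μc).map Complex.ofReal)
        = (s + η * μf * μc) • (1 : Matrix (Fin d) (Fin d) ℂ) := by
      ext i j
      by_cases h : i = j <;> simp [matA, h]
    rw [this, Matrix.smul_mul, Matrix.one_mul, smul_smul, inv_mul_cancel₀ hs, one_smul]
  unfold transferFunction
  rw [hinv]
  ext i j
  rcases i with i | i <;> rcases j with j | j <;> by_cases h : i = j <;>
    simp [matB, matC, matD, Matrix.mul_apply, Matrix.one_apply, h,
      apply_ite Complex.ofReal] <;> field_simp <;> ring_nf <;> simp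

end System

/-- The memoryless map `x ↦ (∇h (x + y) - μ (x + y)) - (∇h y - μ y)`. -/
def shiftedGradient {d : ℕ} (h : Vec d → ℝ) (μ : ℝ) (y x : Vec d) : Vec d :=
  (gradient h (x + y) - μ • (x + y)) - (gradient h y - μ • y)

/-- The nonlinear operator `Δ = diag(Δ₁, Δ₂)` of the error system, acting pointwise in time, where
`Δ₁`, `Δ₂` are the shifted gradients of `f` at `x_opt` and of `φc` (the conjugate of `φ`) at
`z_opt`. -/
def mdNonlinearity {d : ℕ} (f φc : Vec d → ℝ) (μf μc : ℝ) (xopt zopt : Vec d)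
    (v : ℝ → Vec2 d) (t : ℝ) : Vec2 d :=
  stack (shiftedGradient f μf xopt (upper (v t))) (shiftedGradient φc μc zopt (lower (v t)))

/-- `z` is a trajectory on `[0, ∞)` of the mirror descent flow `ż = -η ∇f(∇φc(z))`. -/
def IsMDTrajectory {d : ℕ} (η : ℝ) (f φc : Vec d → ℝ) (z : ℝ → Vec d) : Prop :=
  ∀ t : ℝ, 0 ≤ t →
    HasDerivWithinAt z (-η • gradient f (gradient φc (z t))) (Ici 0) t

end MirrorDescent

end

/-! Write `F₁(x) = ∇f(x + xopt) - ∇f(xopt)`, `ψ` for the conjugate of `φ`, and `F₂(y) = ∇ψ(y + zopt)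
- ∇ψ(zopt)`. The argument is a time-domain Lyapunov argument; no frequency-domain multiplier enters.

The feedthrough `D` is strictly block triangular, so the algebraic loop in `v = G w + g`, `w = Δ v +
e` can be solved explicitly: `v` and `w` are pointwise functions (`loopV`, `loopW`) of the inputs
and of the state `y` of `G`. After substitution the shifts by `μf` and `μc` cancel (`field_loopW`),
leaving `ẏ = -η F₁(v₁) + η μf g₁ - η e₁`, where `v₁ = F₂(y + g₂) + e₂ + g₁ - μc g₂`. Without inputs
this is the mirror descent flow in error coordinates, `ẏ = -η F₁(F₂ y)`. Its right-hand side is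
Lipschitz in `y`, uniformly in the inputs, so well-posedness reduces to existence and uniqueness for
an integral equation (`exists_integral_eq`, `eq_of_integral_eq`).

The Lyapunov function is the Bregman distance of `ψ` at `zopt`, whose gradient is `F₂`. Strong
monotonicity of `F₁` gives `⟪F₂ y, -η F₁(F₂ y)⟫ ≤ -η μf ‖F₂ y‖²`; the inputs perturb this by a term
that Young's inequality absorbs (`exists_inner_loopField_le`). Integration bounds the energy of `F₂
y` by that of the inputs, and `v`, `w` are controlled by `F₂ y`, `g`, `e` (`exists_norm_loop_le`).
The inputs are merely square integrable, so the state is only absolutely continuous, which calls for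
the chain rule `sub_eq_integral_inner_gradient`.

With zero inputs but arbitrary initial state, the same function decays exponentially along the flow,
which gives the convergence. The facts on `ψ` come from `∇ψ` being the inverse of `∇φ`
(`classS.conjugate_mem`). -/

namespace MirrorDescent

/-! ### Inequalities for gradients of strongly convex and smooth functions -/

section Convex

variable {E : Type*} [NormedAddCommGroup E] [InnerProductSpace ℝ E]
  {h : E → ℝ} {h' : E → E} {μ L : ℝ}

theorem le_norm_gradient_sub (hm : ∀ x y, μ * ‖x - y‖ ^ 2 ≤ inner ℝ (h' x - h' y) (x - y))
    (x y : E) : μ * ‖x - y‖ ≤ ‖h' x - h' y‖ := by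
  rcases (norm_nonneg (x - y)).eq_or_lt with h0 | h0
  · simp [← h0]
  · refine le_of_mul_le_mul_right ?_ h0
    linarith [hm x y, real_inner_le_norm (h' x - h' y) (x - y), sq ‖x - y‖]

theorem gradient_injective (hμ : 0 < μ)
    (hm : ∀ x y, μ * ‖x - y‖ ^ 2 ≤ inner ℝ (h' x - h' y) (x - y)) : Function.Injective h' := by
  intro x y hxy
  have := le_norm_gradient_sub hm x y
  rw [hxy, sub_self, norm_zero] at this
  have h2 : ‖x - y‖ = 0 := le_antisymm (nonpos_of_mul_nonpos_right this hμ) (norm_nonneg _)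
  exact sub_eq_zero.1 (norm_eq_zero.1 h2)

variable [CompleteSpace E]

theorem hasDerivAt_comp_line (hd : ∀ x, HasGradientAt h (h' x) x) (x d : E) (t : ℝ) :
    HasDerivAt (fun t : ℝ => h (x + t • d)) (inner ℝ (h' (x + t • d)) d) t := by
  have h1 : HasDerivAt (fun t : ℝ => x + t • d) d t := by
    simpa using ((hasDerivAt_id t).smul_const d).const_add x
  have h2 := (hd (x + t • d)).hasFDerivAt.comp_hasDerivAt t h1
  simpa [Function.comp_def] using h2

/-- Lower bound on the Bregman distance from monotonicity of the gradient. -/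
theorem bregman_ge (hd : ∀ x, HasGradientAt h (h' x) x)
    (hm : ∀ x y, μ * ‖x - y‖ ^ 2 ≤ inner ℝ (h' x - h' y) (x - y)) (x y : E) :
    μ / 2 * ‖y - x‖ ^ 2 ≤ h y - h x - inner ℝ (h' x) (y - x) := by
  set d := y - x with hdd
  -- `h` on the segment, minus its linearization and the claimed quadratic lower bound; the claim is
  -- `k 0 ≤ k 1`.
  let k : ℝ → ℝ := fun t => h (x + t • d) - t * inner ℝ (h' x) d - μ / 2 * ‖d‖ ^ 2 * t ^ 2
  have hk : ∀ t, HasDerivAt k (inner ℝ (h' (x + t • d)) d - inner ℝ (h' x) d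
      - μ / 2 * ‖d‖ ^ 2 * (2 * t)) t := fun t => by
    have := ((hasDerivAt_comp_line hd x d t).sub
      ((hasDerivAt_id t).mul_const (inner ℝ (h' x) d))).sub
      ((hasDerivAt_pow 2 t).const_mul (μ / 2 * ‖d‖ ^ 2))
    exact this.congr_deriv (by simp)
  have hmono : MonotoneOn k (Icc 0 1) := by
    refine monotoneOn_of_deriv_nonneg (convex_Icc 0 1)
      (fun t _ => (hk t).continuousAt.continuousWithinAt)
      (fun t _ => (hk t).differentiableAt.differentiableWithinAt) fun t ht => ?_
    rw [interior_Icc] at ht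
    rw [(hk t).deriv]
    have h1 := hm (x + t • d) x
    rw [add_sub_cancel_left, norm_smul, inner_smul_right, mul_pow, Real.norm_eq_abs, sq_abs,
      inner_sub_left] at h1
    have h2 : t * (μ * t * ‖d‖ ^ 2) ≤ t * (inner ℝ (h' (x + t • d)) d - inner ℝ (h' x) d) := by
      linarith
    have h3 := le_of_mul_le_mul_left h2 ht.1
    linarith
  have h01 := hmono (left_mem_Icc.2 zero_le_one) (right_mem_Icc.2 zero_le_one) zero_le_one
  simp only [k, zero_smul, one_smul, add_zero, hdd, add_sub_cancel] at h01
  simp only [hdd]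
  linarith

/-- Upper bound on the Bregman distance (descent lemma). -/
theorem bregman_le (hd : ∀ x, HasGradientAt h (h' x) x)
    (hm : ∀ x y, inner ℝ (h' x - h' y) (x - y) ≤ L * ‖x - y‖ ^ 2) (x y : E) :
    h y - h x - inner ℝ (h' x) (y - x) ≤ L / 2 * ‖y - x‖ ^ 2 := by
  have h1 : ∀ x, HasGradientAt (fun x => -h x) (-h' x) x := fun x => by
    rw [hasGradientAt_iff_hasFDerivAt, map_neg]
    exact (hd x).hasFDerivAt.neg
  -- The lower bound holds for a constant of any sign, so it applies to `-h` with `-L`.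
  have h2 := bregman_ge (h := fun x => -h x) (h' := fun x => -h' x) (μ := -L) h1
    (fun x y => by
      have := hm x y
      rw [← neg_sub', inner_neg_left]
      linarith) x y
  rw [inner_neg_left] at h2
  linarith

/-- Convexity bounds `h` from below, by its linearization at `x`, at the point `y - L⁻¹ • D`; the
descent lemma bounds it from above there. The step `L⁻¹` minimizes the quadratic upper model at `y`
of `h` minus that linearization. -/
theorem bregman_ge_norm_gradient_sq (hL : 0 < L) (hd : ∀ x, HasGradientAt h (h' x) x)
    (hm : ∀ x y, 0 ≤ inner ℝ (h' x - h' y) (x - y))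
    (hM : ∀ x y, inner ℝ (h' x - h' y) (x - y) ≤ L * ‖x - y‖ ^ 2) (x y : E) :
    ‖h' y - h' x‖ ^ 2 / (2 * L) ≤ h y - h x - inner ℝ (h' x) (y - x) := by
  set D := h' y - h' x with hD
  have h1 := bregman_ge (μ := 0) hd (fun x y => by simpa using hm x y) x (y - L⁻¹ • D)
  have h2 := bregman_le hd hM y (y - L⁻¹ • D)
  have e1 : y - L⁻¹ • D - x = (y - x) - L⁻¹ • D := by abel
  have e2 : y - L⁻¹ • D - y = -(L⁻¹ • D) := by abel
  rw [e1, inner_sub_right, inner_smul_right] at h1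
  rw [e2, inner_neg_right, inner_smul_right, norm_neg, norm_smul, mul_pow, Real.norm_eq_abs,
    sq_abs] at h2
  have h3 : inner ℝ (h' y) D - inner ℝ (h' x) D = ‖D‖ ^ 2 := by
    rw [← inner_sub_left, ← hD, real_inner_self_eq_norm_sq]
  have h4 : L / 2 * (L⁻¹ ^ 2 * ‖D‖ ^ 2) = L⁻¹ * ‖D‖ ^ 2 / 2 := by field_simp
  have h5 : ‖D‖ ^ 2 / (2 * L) = L⁻¹ * ‖D‖ ^ 2 / 2 := by field_simp
  rw [h5]
  have h6 : L⁻¹ * inner ℝ (h' y) D - L⁻¹ * inner ℝ (h' x) D = L⁻¹ * ‖D‖ ^ 2 := by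
    rw [← h3]; ring
  rw [h4] at h2
  linarith

/-- Cocoercivity of the gradient of a convex smooth function (Baillon–Haddad). -/
theorem norm_gradient_sub_sq_le (hL : 0 < L) (hd : ∀ x, HasGradientAt h (h' x) x)
    (hm : ∀ x y, 0 ≤ inner ℝ (h' x - h' y) (x - y))
    (hM : ∀ x y, inner ℝ (h' x - h' y) (x - y) ≤ L * ‖x - y‖ ^ 2) (x y : E) :
    ‖h' x - h' y‖ ^ 2 ≤ L * inner ℝ (h' x - h' y) (x - y) := by
  have h1 := bregman_ge_norm_gradient_sq hL hd hm hM x y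
  have h2 := bregman_ge_norm_gradient_sq hL hd hm hM y x
  rw [norm_sub_rev] at h1
  rw [← neg_sub x y, inner_neg_right] at h1
  rw [inner_sub_left]
  have h3 : ‖h' x - h' y‖ ^ 2 / (2 * L) + ‖h' x - h' y‖ ^ 2 / (2 * L)
      ≤ inner ℝ (h' x) (x - y) - inner ℝ (h' y) (x - y) := by linarith
  have h4 : ‖h' x - h' y‖ ^ 2 = L * (‖h' x - h' y‖ ^ 2 / (2 * L) + ‖h' x - h' y‖ ^ 2 / (2 * L)) := by
    field_simp; ring
  rw [h4]
  exact mul_le_mul_of_nonneg_left h3 hL.le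

theorem norm_gradient_sub_le (hL : 0 < L) (hd : ∀ x, HasGradientAt h (h' x) x)
    (hm : ∀ x y, 0 ≤ inner ℝ (h' x - h' y) (x - y))
    (hM : ∀ x y, inner ℝ (h' x - h' y) (x - y) ≤ L * ‖x - y‖ ^ 2) (x y : E) :
    ‖h' x - h' y‖ ≤ L * ‖x - y‖ := by
  have h1 := norm_gradient_sub_sq_le hL hd hm hM x y
  have h2 := mul_le_mul_of_nonneg_left (hM x y) hL.le
  refine abs_le_of_sq_le_sq' ?_ (by positivity) |>.2
  linarith [mul_pow L ‖x - y‖ 2]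

/-- The gradient of a strongly convex function is surjective. -/
theorem exists_gradient_eq [ProperSpace E] (hμ : 0 < μ) (hd : ∀ x, HasGradientAt h (h' x) x)
    (hm : ∀ x y, μ * ‖x - y‖ ^ 2 ≤ inner ℝ (h' x - h' y) (x - y)) (z : E) :
    ∃ x, h' x = z := by
  -- A critical point of the tilted function solves `h' x = z`; strong convexity makes it coercive,
  -- so a minimizer exists.
  let k : E → ℝ := fun x => h x - inner ℝ z x
  have hk : ∀ x, HasGradientAt k (h' x - z) x := fun x => by
    rw [hasGradientAt_iff_hasFDerivAt, map_sub]
    exact (hd x).hasFDerivAt.sub (InnerProductSpace.toDual ℝ E z).hasFDerivAt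
  have hc : Continuous k := continuous_iff_continuousAt.2 fun x => (hk x).continuousAt
  have hlim : Tendsto k (cocompact E) atTop := by
    have hb : ∀ y, ‖y‖ * (μ / 2 * ‖y‖ - ‖h' 0 - z‖) + k 0 ≤ k y := fun y => by
      have h1 := bregman_ge (μ := μ) hk (fun x y => by simpa using hm x y) 0 y
      rw [sub_zero] at h1
      have h2 := neg_le_of_abs_le (abs_real_inner_le_norm (h' 0 - z) y)
      nlinarith
    refine tendsto_atTop_mono hb (tendsto_atTop_add_const_right _ _ ?_)
    have hn := tendsto_norm_cocompact_atTop (E := E)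
    refine hn.atTop_mul_atTop₀ (tendsto_atTop_add_const_right _ _ ?_)
    exact hn.const_mul_atTop (by positivity)
  obtain ⟨x, hx⟩ := hc.exists_forall_le hlim
  refine ⟨x, ?_⟩
  have h0 := IsLocalMin.hasFDerivAt_eq_zero (Eventually.of_forall hx) (hk x).hasFDerivAt
  exact sub_eq_zero.1 ((LinearIsometryEquiv.map_eq_zero_iff _).1 h0)

end Convex

/-! ### The class `S(μ, L)` and convex conjugates -/

section ClassS

variable {d : ℕ} {μ L : ℝ} {f : Vec d → ℝ}

theorem classS.hasGradientAt (hf : f ∈ classS μ L) (x : Vec d) :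
    HasGradientAt f (gradient f x) x :=
  ((hf.1.differentiable one_ne_zero) x).hasGradientAt

theorem classS.monotone (hf : f ∈ classS μ L) (hμ : 0 ≤ μ) (x y : Vec d) :
    0 ≤ inner ℝ (gradient f x - gradient f y) (x - y) :=
  (by positivity : 0 ≤ μ * ‖x - y‖ ^ 2).trans (hf.2 x y).1

theorem classS.norm_gradient_sub_le (hf : f ∈ classS μ L) (hμ : 0 ≤ μ) (hL : 0 < L)
    (x y : Vec d) : ‖gradient f x - gradient f y‖ ≤ L * ‖x - y‖ :=
  MirrorDescent.norm_gradient_sub_le hL (classS.hasGradientAt hf) (classS.monotone hf hμ)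
    (fun x y => (hf.2 x y).2) x y

theorem classS.isMinimizer_iff (hf : f ∈ classS μ L) (hμ : 0 ≤ μ) (x : Vec d) :
    (∀ y, f x ≤ f y) ↔ gradient f x = 0 := by
  constructor
  · intro hx
    have h0 := IsLocalMin.hasFDerivAt_eq_zero (Eventually.of_forall hx)
      (classS.hasGradientAt hf x).hasFDerivAt
    exact (LinearIsometryEquiv.map_eq_zero_iff _).1 h0
  · intro hx y
    have := bregman_ge (classS.hasGradientAt hf) (fun x y => (hf.2 x y).1) x y
    rw [hx, inner_zero_left] at this
    have h2 : 0 ≤ μ / 2 * ‖y - x‖ ^ 2 := by positivity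
    linarith

/-- The conjugate of a strongly convex smooth function is differentiable, and its gradient is the
inverse of the gradient of the function. -/
theorem classS.hasGradientAt_conjugate (hf : f ∈ classS μ L) (hμ : 0 < μ) (x : Vec d) :
    HasGradientAt (conjugate f) x (gradient f x) := by
  have hval : ∀ x, conjugate f (gradient f x) = inner ℝ x (gradient f x) - f x := fun x => by
    have hle : ∀ y, inner ℝ y (gradient f x) - f y ≤ inner ℝ x (gradient f x) - f x := fun y => by
      have h1 := bregman_ge (classS.hasGradientAt hf) (fun x y => (hf.2 x y).1) x y
      rw [inner_sub_right, real_inner_comm, real_inner_comm x] at h1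
      have h2 : 0 ≤ μ / 2 * ‖y - x‖ ^ 2 := by positivity
      linarith
    exact (IsGreatest.csSup_eq ⟨⟨x, rfl⟩, by rintro _ ⟨y, rfl⟩; exact hle y⟩ :
      sSup (range fun y => inner ℝ y (gradient f x) - f y) = _)
  rw [hasGradientAt_iff_isLittleO]
  -- At `z = ∇f y` the Taylor remainder of the conjugate at `∇f x` is the Bregman distance `f x - f
  -- y - ⟪∇f y, x - y⟫`. It is at most `⟪∇f y - ∇f x, y - x⟫`, hence at most `μ⁻¹ ‖∇f y - ∇f x‖²`.
  refine Asymptotics.IsBigO.trans_isLittleO (g := fun z => ‖z - gradient f x‖ ^ 2) ?_ ?_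
  · refine Asymptotics.IsBigO.of_bound μ⁻¹ (Eventually.of_forall fun z => ?_)
    obtain ⟨y, rfl⟩ := exists_gradient_eq hμ (classS.hasGradientAt hf)
      (fun x y => (hf.2 x y).1) z
    rw [hval, hval]
    have h1 := bregman_ge (classS.hasGradientAt hf) (fun x y => (hf.2 x y).1) x y
    have h2 := bregman_ge (classS.hasGradientAt hf) (fun x y => (hf.2 x y).1) y x
    have h3 := le_norm_gradient_sub (fun x y => (hf.2 x y).1) y x
    have h4 : 0 ≤ μ / 2 * ‖y - x‖ ^ 2 := by positivity
    have h5 : 0 ≤ μ / 2 * ‖x - y‖ ^ 2 := by positivity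
    have h6 := real_inner_le_norm (gradient f y - gradient f x) (y - x)
    have h7 : ‖y - x‖ ≤ μ⁻¹ * ‖gradient f y - gradient f x‖ := by
      rw [inv_mul_eq_div, le_div_iff₀ hμ]; linarith
    have h8 := mul_le_mul_of_nonneg_left h7 (norm_nonneg (gradient f y - gradient f x))
    have e1 : inner ℝ y (gradient f y) = inner ℝ (gradient f y) y := real_inner_comm _ _
    have e2 : inner ℝ x (gradient f x) = inner ℝ (gradient f x) x := real_inner_comm _ _
    have e3 : inner ℝ x (gradient f y) = inner ℝ (gradient f y) x := real_inner_comm _ _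
    simp only [inner_sub_left, inner_sub_right] at h1 h2 h6 ⊢
    rw [Real.norm_eq_abs, abs_of_nonneg (by linarith), Real.norm_eq_abs,
      abs_of_nonneg (by positivity)]
    nlinarith
  · have h1 : Tendsto (fun z => ‖z - gradient f x‖) (𝓝 (gradient f x)) (𝓝 0) := by
      have : Continuous fun z => ‖z - gradient f x‖ := by fun_prop
      simpa using this.tendsto (gradient f x)
    have h2 := (Asymptotics.isLittleO_one_iff ℝ).2 h1
    have h3 := h2.mul_isBigO (Asymptotics.isBigO_refl (fun z => ‖z - gradient f x‖) _)
    simp only [one_mul] at h3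
    simpa [sq] using h3.norm_right

theorem classS.gradient_conjugate (hf : f ∈ classS μ L) (hμ : 0 < μ) (x : Vec d) :
    gradient (conjugate f) (gradient f x) = x :=
  (classS.hasGradientAt_conjugate hf hμ x).gradient

theorem classS.gradient_gradient_conjugate (hf : f ∈ classS μ L) (hμ : 0 < μ) (z : Vec d) :
    gradient f (gradient (conjugate f) z) = z := by
  obtain ⟨x, rfl⟩ := exists_gradient_eq hμ (classS.hasGradientAt hf) (fun x y => (hf.2 x y).1) z
  rw [classS.gradient_conjugate hf hμ]

/-- Both constants come from inverting `∇f`: strong monotonicity of `∇f` makes the inverse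
`μ⁻¹`-Lipschitz, and cocoercivity of `∇f` is strong monotonicity of the inverse with constant `L⁻¹`.
-/
theorem classS.conjugate_mem (hf : f ∈ classS μ L) (hμ : 0 < μ) (hL : 0 < L) :
    conjugate f ∈ classS L⁻¹ μ⁻¹ := by
  have hg := classS.gradient_gradient_conjugate hf hμ
  have hgrad : ∀ z, HasGradientAt (conjugate f) (gradient (conjugate f) z) z := fun z => by
    have := classS.hasGradientAt_conjugate hf hμ (gradient (conjugate f) z)
    rwa [hg] at this
  have hlip : ∀ x y, ‖gradient (conjugate f) x - gradient (conjugate f) y‖ ≤ μ⁻¹ * ‖x - y‖ :=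
    fun x y => by
      have := le_norm_gradient_sub (fun x y => (hf.2 x y).1) (gradient (conjugate f) x)
        (gradient (conjugate f) y)
      rw [hg, hg] at this
      rwa [inv_mul_eq_div, le_div_iff₀ hμ, mul_comm]
  refine ⟨?_, fun x y => ⟨?_, ?_⟩⟩
  · rw [contDiff_one_iff_hasFDerivAt]
    refine ⟨fun z => InnerProductSpace.toDual ℝ (Vec d) (gradient (conjugate f) z), ?_,
      fun z => (hgrad z).hasFDerivAt⟩
    refine (InnerProductSpace.toDual ℝ (Vec d)).continuous.comp ?_
    exact (LipschitzWith.of_dist_le' fun x y => by simpa only [dist_eq_norm] using hlip x y).continuous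
  · have := norm_gradient_sub_sq_le hL (classS.hasGradientAt hf) (classS.monotone hf hμ.le)
      (fun x y => (hf.2 x y).2) (gradient (conjugate f) x) (gradient (conjugate f) y)
    rw [hg, hg, real_inner_comm] at this
    rwa [inv_mul_eq_div, div_le_iff₀ hL, mul_comm]
  · have h1 := real_inner_le_norm (gradient (conjugate f) x - gradient (conjugate f) y) (x - y)
    have h2 := mul_le_mul_of_nonneg_right (hlip x y) (norm_nonneg (x - y))
    linarith [sq ‖x - y‖]

end ClassS

/-! ### Absolutely continuous functions -/

section AbsolutelyContinuous

/-- A comparison principle, applied to a primitive against the primitive of the norm, and to a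
locally Lipschitz function composed with a primitive. -/
theorem absolutelyContinuousOnInterval_of_dist_le {X Y : Type*} [PseudoMetricSpace X]
    [PseudoMetricSpace Y] {f : ℝ → X} {g : ℝ → Y} {a b K : ℝ}
    (hg : AbsolutelyContinuousOnInterval g a b)
    (h : ∀ x ∈ uIcc a b, ∀ y ∈ uIcc a b, dist (f x) (f y) ≤ K * dist (g x) (g y)) :
    AbsolutelyContinuousOnInterval f a b := by
  have hg' : Tendsto _ _ _ := hg
  refine squeeze_zero' (Eventually.of_forall fun E => Finset.sum_nonneg fun i _ => dist_nonneg) ?_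
    (by simpa using hg'.const_mul K)
  filter_upwards [mem_inf_of_right (mem_principal_self _)] with E hE
  rw [Finset.mul_sum]
  exact Finset.sum_le_sum fun i hi => h _ (hE.1 i hi).1 _ (hE.1 i hi).2

variable {E : Type*} [NormedAddCommGroup E] [NormedSpace ℝ E]

theorem absolutelyContinuousOnInterval_primitive {f : ℝ → E} {T : ℝ} (hT : 0 ≤ T)
    (hf : IntervalIntegrable f volume 0 T) :
    AbsolutelyContinuousOnInterval (fun t => ∫ s in (0 : ℝ)..t, f s) 0 T := by
  refine absolutelyContinuousOnInterval_of_dist_le (K := 1)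
    (hf.norm.absolutelyContinuousOnInterval_intervalIntegral left_mem_uIcc) fun x hx y hy => ?_
  rw [uIcc_of_le hT] at hx hy
  have hi : ∀ t ∈ Icc 0 T, IntervalIntegrable f volume 0 t := fun t ht =>
    hf.mono_set (by rw [uIcc_of_le hT, uIcc_of_le ht.1]; exact Icc_subset_Icc_right ht.2)
  rw [dist_eq_norm, dist_eq_norm, one_mul,
    intervalIntegral.integral_interval_sub_left (hi x hx) (hi y hy),
    intervalIntegral.integral_interval_sub_left (hi x hx).norm (hi y hy).norm, Real.norm_eq_abs]
  exact intervalIntegral.norm_integral_le_abs_integral_norm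

/-- Fundamental theorem of calculus for absolutely continuous functions. -/
theorem sub_eq_integral_of_absolutelyContinuous [CompleteSpace E] {u u' : ℝ → E} {T : ℝ}
    (hT : 0 ≤ T) (hu : AbsolutelyContinuousOnInterval u 0 T)
    (hu' : IntervalIntegrable u' volume 0 T)
    (hd : ∀ᵐ t, t ∈ uIcc 0 T → HasDerivAt u (u' t) t) :
    u T - u 0 = ∫ s in (0 : ℝ)..T, u' s := by
  -- The difference of `u` and the primitive of `u'` is absolutely continuous with zero derivative
  -- almost everywhere, hence constant.
  obtain ⟨C, hC⟩ := (hu.sub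
    (absolutelyContinuousOnInterval_primitive hT hu')).const_of_ae_hasDerivAt_zero (by
      filter_upwards [hd, hu'.ae_hasDerivAt_integral] with t h1 h2 ht
      simpa using (h1 ht).sub (h2 ht 0 left_mem_uIcc))
  have h0 := hC 0 left_mem_uIcc
  have h1 := hC T right_mem_uIcc
  simp only [Pi.sub_apply, intervalIntegral.integral_same, sub_zero] at h0 h1
  rw [h0, ← h1, sub_sub_cancel]

end AbsolutelyContinuous

/-! ### Existence and uniqueness for Lipschitz integral equations -/

section IntegralEquation

variable {E : Type*} [NormedAddCommGroup E] [NormedSpace ℝ E]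

/-- Uniqueness for integral equations with Lipschitz right hand side. -/
theorem eq_of_integral_eq {u u' b b' : ℝ → E} {T K : ℝ} (hT : 0 ≤ T) (hK : 0 < K)
    (hu : ContinuousOn u (Icc 0 T)) (hu' : ContinuousOn u' (Icc 0 T))
    (hb : IntervalIntegrable b volume 0 T) (hb' : IntervalIntegrable b' volume 0 T)
    (hub : ∀ t ∈ Icc 0 T, u t = ∫ s in (0 : ℝ)..t, b s)
    (hub' : ∀ t ∈ Icc 0 T, u' t = ∫ s in (0 : ℝ)..t, b' s)
    (hlip : ∀ᵐ t ∂volume.restrict (Icc 0 T), ‖b t - b' t‖ ≤ K * ‖u t - u' t‖) :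
    ∀ t ∈ Icc 0 T, u t = u' t := by
  -- The rate `2 * K` in the weight makes integration gain a factor `1/2`: at a maximum point `M
  -- e^{2Kτ} ≤ M (e^{2Kτ} - 1) / 2`, which forces `M = 0`.
  obtain ⟨τ, hτ, hmax⟩ := isCompact_Icc.exists_isMaxOn (nonempty_Icc.2 hT)
    (f := fun t => Real.exp (-(2 * K * t)) * ‖u t - u' t‖)
    (ContinuousOn.mul (by fun_prop) (hu.sub hu').norm)
  set M := Real.exp (-(2 * K * τ)) * ‖u τ - u' τ‖ with hM
  have hle : ∀ t ∈ Icc 0 T, ‖u t - u' t‖ ≤ M * Real.exp (2 * K * t) := fun t ht => by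
    have h1 : Real.exp (-(2 * K * t)) * ‖u t - u' t‖ ≤ M := hmax ht
    rw [Real.exp_neg, inv_mul_le_iff₀ (Real.exp_pos _)] at h1
    linarith
  have hsub : Icc 0 τ ⊆ Icc 0 T := Icc_subset_Icc_right hτ.2
  have hsub' : uIcc 0 τ ⊆ uIcc 0 T := by rwa [uIcc_of_le hT, uIcc_of_le hτ.1]
  have hint : ∫ s in (0 : ℝ)..τ, K * (M * Real.exp (2 * K * s))
      = M * (Real.exp (2 * K * τ) - 1) / 2 := by
    rw [intervalIntegral.integral_const_mul, intervalIntegral.integral_const_mul,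
      intervalIntegral.integral_comp_mul_left (fun x => Real.exp x) (by positivity), integral_exp]
    simp
    field_simp
  have h2 : ‖u τ - u' τ‖ ≤ M * (Real.exp (2 * K * τ) - 1) / 2 := by
    rw [hub τ hτ, hub' τ hτ, ← intervalIntegral.integral_sub (hb.mono_set hsub')
      (hb'.mono_set hsub'), ← hint]
    refine intervalIntegral.norm_integral_le_of_norm_le hτ.1 ?_
      (Continuous.intervalIntegrable (by fun_prop) _ _)
    rw [ae_restrict_iff' measurableSet_Icc] at hlip
    filter_upwards [hlip] with t ht htτ
    have ht' : t ∈ Icc 0 T := hsub (Ioc_subset_Icc_self htτ)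
    exact (ht ht').trans (mul_le_mul_of_nonneg_left (hle t ht') hK.le)
  have h3 : ‖u τ - u' τ‖ = M * Real.exp (2 * K * τ) := by
    rw [hM, Real.exp_neg, inv_mul_eq_div, div_mul_cancel₀ _ (Real.exp_pos _).ne']
  have hM0 : 0 ≤ M := by positivity
  have hM1 : M = 0 := by nlinarith [Real.exp_pos (2 * K * τ)]
  intro t ht
  have h4 := hle t ht
  rw [hM1, zero_mul] at h4
  exact sub_eq_zero.1 (norm_le_zero_iff.1 h4)

/-- Freezing the primitive at negative times lets the fixed point argument run on bounded continuous
functions on all of `ℝ`. -/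
theorem continuous_primitive_max {b : ℝ → E}
    (hb : ∀ T, 0 ≤ T → IntervalIntegrable b volume 0 T) :
    Continuous fun t => ∫ s in (0 : ℝ)..max t 0, b s := by
  refine continuous_iff_continuousAt.2 fun t₀ => ?_
  have hT : (0 : ℝ) ≤ |t₀| + 1 := by positivity
  have h1 := intervalIntegral.continuousOn_primitive_interval' (hb _ hT) left_mem_uIcc
  rw [uIcc_of_le hT] at h1
  have h2 : ContinuousOn (fun t => ∫ s in (0 : ℝ)..max t 0, b s) (Iic (|t₀| + 1)) :=
    h1.comp (by fun_prop) fun t ht => ⟨le_max_right _ _, max_le ht hT⟩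
  exact h2.continuousAt (Iic_mem_nhds (by linarith [le_abs_self t₀]))

/-- Global existence for integral equations with Lipschitz right hand side. -/
theorem exists_integral_eq [CompleteSpace E] {Φ : ℝ → E → E} {K : ℝ} (hK : 0 < K)
    (hint : ∀ u : ℝ → E, Continuous u → ∀ T, 0 ≤ T →
      IntervalIntegrable (fun s => Φ s (u s)) volume 0 T)
    (hlip : ∀ s x y, ‖Φ s x - Φ s y‖ ≤ K * ‖x - y‖) :
    ∃ u : ℝ → E, Continuous u ∧ ∀ t, 0 ≤ t → u t = ∫ s in (0 : ℝ)..t, Φ s (u s) := by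
  -- The weight `ρ = e^{2Kt} m(t)` must dominate the integral of `Φ s 0`, which has no a priori
  -- growth bound; hence the factor `m`. The summand `1` keeps it positive, and its monotonicity
  -- lets it leave the integral.
  let m : ℝ → ℝ := fun t => 1 + ∫ s in (0 : ℝ)..max t 0, ‖Φ s 0‖
  have hm1 : ∀ t, 1 ≤ m t := fun t => le_add_of_nonneg_right
    (intervalIntegral.integral_nonneg (le_max_right _ _) fun _ _ => norm_nonneg _)
  have hΦ0 : ∀ T, 0 ≤ T → IntervalIntegrable (fun s => Φ s 0) volume 0 T :=
    hint (fun _ => 0) continuous_const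
  have hmc : Continuous m := continuous_const.add (continuous_primitive_max fun T hT => (hΦ0 T hT).norm)
  have hmm : ∀ s t, 0 ≤ s → s ≤ t → m s ≤ m t := fun s t hs hst => by
    have ht := hs.trans hst
    simp only [m, max_eq_left hs, max_eq_left ht]
    gcongr
    exact intervalIntegral.integral_mono_interval le_rfl hs hst
      (Eventually.of_forall fun _ => norm_nonneg _) (hΦ0 t ht).norm
  let ρ : ℝ → ℝ := fun t => Real.exp (2 * K * max t 0) * m t
  have hρc : Continuous ρ := by fun_prop
  have hρ0 : ∀ t, 0 < ρ t := fun t => mul_pos (Real.exp_pos _) (zero_lt_one.trans_le (hm1 t))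
  have hmρ : ∀ t, m t ≤ ρ t := fun t => le_mul_of_one_le_left (zero_le_one.trans (hm1 t))
    (Real.one_le_exp (by positivity))
  have key : ∀ (a : ℝ → E) (C t : ℝ), 0 ≤ C → (∀ s, ‖a s‖ ≤ K * (C * ρ s)) →
      ‖∫ s in (0 : ℝ)..max t 0, a s‖ ≤ C / 2 * ρ t := fun a C t hC ha => by
    have hτ : 0 ≤ max t 0 := le_max_right _ _
    have hmt : m (max t 0) = m t := by simp only [m, max_eq_left hτ]
    refine (intervalIntegral.norm_integral_le_of_norm_le hτ
      (g := fun s => K * C * m t * Real.exp (2 * K * s)) (Eventually.of_forall fun s hs => ?_)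
      (Continuous.intervalIntegrable (by fun_prop) _ _)).trans ?_
    · refine (ha s).trans ?_
      have h1 : ρ s ≤ Real.exp (2 * K * s) * m t := by
        simp only [ρ, max_eq_left hs.1.le]
        gcongr
        rw [← hmt]
        exact hmm s _ hs.1.le hs.2
      have := mul_le_mul_of_nonneg_left h1 (mul_nonneg hK.le hC)
      linarith
    · rw [intervalIntegral.integral_const_mul,
        intervalIntegral.integral_comp_mul_left (fun x => Real.exp x) (by positivity), integral_exp]
      have h1 : K * C * m t * ((2 * K)⁻¹ • (Real.exp (2 * K * max t 0) - Real.exp (2 * K * 0)))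
          = C / 2 * ρ t - C / 2 * m t := by
        simp only [smul_eq_mul, mul_zero, Real.exp_zero, ρ]
        field_simp
      rw [h1]
      have := hm1 t
      have : 0 ≤ C / 2 * m t := by positivity
      linarith
  have hint' : ∀ u : BoundedContinuousFunction ℝ E, ∀ T, 0 ≤ T →
      IntervalIntegrable (fun s => Φ s (ρ s • u s)) volume 0 T := fun u =>
    hint _ (hρc.smul u.continuous)
  -- The Picard map conjugated by multiplication by `ρ`. By `key` it halves distances in the sup
  -- norm on the whole half line, so no continuation argument is needed.
  let P : BoundedContinuousFunction ℝ E → BoundedContinuousFunction ℝ E := fun u =>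
    BoundedContinuousFunction.ofNormedAddCommGroup
      (fun t => (ρ t)⁻¹ • ∫ s in (0 : ℝ)..max t 0, Φ s (ρ s • u s))
      ((hρc.inv₀ fun t => (hρ0 t).ne').smul (continuous_primitive_max (hint' u))) (‖u‖ / 2 + 1) fun t => by
        rw [norm_smul, norm_inv, Real.norm_of_nonneg (hρ0 t).le, inv_mul_le_iff₀ (hρ0 t)]
        have h1 := key (fun s => Φ s (ρ s • u s) - Φ s 0) ‖u‖ t (norm_nonneg _) fun s => by
          refine (hlip _ _ _).trans (mul_le_mul_of_nonneg_left ?_ hK.le)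
          rw [sub_zero, norm_smul, Real.norm_of_nonneg (hρ0 s).le, mul_comm]
          exact mul_le_mul_of_nonneg_right (u.norm_coe_le_norm s) (hρ0 s).le
        have hτ : 0 ≤ max t 0 := le_max_right _ _
        rw [intervalIntegral.integral_sub (hint' u _ hτ) (hΦ0 _ hτ)] at h1
        have h2 : ‖∫ s in (0 : ℝ)..max t 0, Φ s 0‖ ≤ m t :=
          (intervalIntegral.norm_integral_le_integral_norm hτ).trans (by simp [m])
        have h3 := norm_le_norm_sub_add (∫ s in (0 : ℝ)..max t 0, Φ s (ρ s • u s))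
          (∫ s in (0 : ℝ)..max t 0, Φ s 0)
        linarith [hmρ t]
  have hP : ContractingWith (1 / 2) P := by
    refine ⟨by norm_num, LipschitzWith.of_dist_le_mul fun u u' => ?_⟩
    refine (BoundedContinuousFunction.dist_le (by positivity)).2 fun t => ?_
    have hτ : 0 ≤ max t 0 := le_max_right _ _
    have h1 := key (fun s => Φ s (ρ s • u s) - Φ s (ρ s • u' s)) (dist u u') t dist_nonneg
      fun s => by
        refine (hlip _ _ _).trans (mul_le_mul_of_nonneg_left ?_ hK.le)
        rw [← smul_sub, norm_smul, Real.norm_of_nonneg (hρ0 s).le, mul_comm, ← dist_eq_norm]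
        exact mul_le_mul_of_nonneg_right (BoundedContinuousFunction.dist_coe_le_dist s) (hρ0 s).le
    rw [intervalIntegral.integral_sub (hint' u _ hτ) (hint' u' _ hτ)] at h1
    simp only [P, BoundedContinuousFunction.coe_ofNormedAddCommGroup]
    rw [dist_eq_norm, ← smul_sub, norm_smul, norm_inv, Real.norm_of_nonneg (hρ0 t).le,
      inv_mul_le_iff₀ (hρ0 t)]
    refine h1.trans (le_of_eq ?_)
    push_cast
    ring
  obtain ⟨u, hu⟩ : ∃ u, P u = u := ⟨_, hP.fixedPoint_isFixedPt⟩
  refine ⟨fun t => ρ t • u t, hρc.smul u.continuous, fun t ht => ?_⟩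
  have h1 : u t = (ρ t)⁻¹ • ∫ s in (0 : ℝ)..max t 0, Φ s (ρ s • u s) := by
    conv_lhs => rw [← hu]
    rfl
  rw [max_eq_left ht] at h1
  simp only
  rw [h1, smul_inv_smul₀ (hρ0 t).ne']

end IntegralEquation

/-! ### Stacked vectors -/

section Stacked

variable {d : ℕ}

/-- `upper` as a continuous linear map. -/
noncomputable def upperL (d : ℕ) : Vec2 d →L[ℝ] Vec d :=
  LinearMap.toContinuousLinearMap
    { toFun := upper, map_add' := fun _ _ => rfl, map_smul' := fun _ _ => rfl }

/-- `lower` as a continuous linear map. -/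
noncomputable def lowerL (d : ℕ) : Vec2 d →L[ℝ] Vec d :=
  LinearMap.toContinuousLinearMap
    { toFun := lower, map_add' := fun _ _ => rfl, map_smul' := fun _ _ => rfl }

/-- `stack` as a continuous linear map. -/
noncomputable def stackL (d : ℕ) : Vec d × Vec d →L[ℝ] Vec2 d :=
  LinearMap.toContinuousLinearMap
    { toFun := fun p => stack p.1 p.2
      map_add' := fun p q => by ext (i | i) <;> simp [stack]
      map_smul' := fun c p => by ext (i | i) <;> simp [stack] }

@[simp] theorem stackL_apply (p : Vec d × Vec d) : stackL d p = stack p.1 p.2 := rfl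
@[simp] theorem upper_stack (a b : Vec d) : upper (stack a b) = a := rfl
@[simp] theorem lower_stack (a b : Vec d) : lower (stack a b) = b := rfl
@[simp] theorem upper_add (v w : Vec2 d) : upper (v + w) = upper v + upper w := rfl
@[simp] theorem lower_add (v w : Vec2 d) : lower (v + w) = lower v + lower w := rfl

@[simp] theorem stack_upper_lower (v : Vec2 d) : stack (upper v) (lower v) = v := by
  ext (i | i) <;> rfl

theorem norm_sq_eq_upper_lower (v : Vec2 d) : ‖v‖ ^ 2 = ‖upper v‖ ^ 2 + ‖lower v‖ ^ 2 := by
  simp [EuclideanSpace.norm_sq_eq, Fintype.sum_sum_type, upper, lower]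

end Stacked

/-! ### The signal spaces -/

section Signals

variable {E F : Type*} [NormedAddCommGroup E] [NormedAddCommGroup F]

theorem L2e.add {u v : ℝ → E} (hu : u ∈ L2e E) (hv : v ∈ L2e E) : u + v ∈ L2e E :=
  fun T => (hu T).add (hv T)

theorem L2e.of_lipschitz {u : ℝ → E} (hu : u ∈ L2e E) {g : E → F} {K : ℝ}
    (hg : ∀ x y, ‖g x - g y‖ ≤ K * ‖x - y‖) (g0 : g 0 = 0) : (fun t => g (u t)) ∈ L2e F :=
  fun T => (LipschitzWith.of_dist_le' fun x y => by
    simpa only [dist_eq_norm] using hg x y).comp_memLp g0 (hu T)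

theorem L2e.congr {u v : ℝ → E} (hu : u ∈ L2e E) (h : u =ᵐ[volume.restrict (Ici 0)] v) :
    v ∈ L2e E :=
  fun T => (hu T).ae_eq (ae_restrict_of_ae_restrict_of_subset Icc_subset_Ici_self h)

theorem L2e.intervalIntegrable {u : ℝ → E} (hu : u ∈ L2e E) {T : ℝ} (hT : 0 ≤ T) :
    IntervalIntegrable u volume 0 T := by
  rw [intervalIntegrable_iff_integrableOn_Icc_of_le hT]
  exact (hu T).integrable (by norm_num)

theorem L2e.intervalIntegrable_norm_sq {u : ℝ → E} (hu : u ∈ L2e E) {T : ℝ} (hT : 0 ≤ T) :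
    IntervalIntegrable (fun t => ‖u t‖ ^ 2) volume 0 T := by
  rw [intervalIntegrable_iff_integrableOn_Icc_of_le hT]
  exact (memLp_two_iff_integrable_sq_norm (hu T).1).1 (hu T)

theorem L2e.of_continuousOn {u : ℝ → E} (hu : ∀ T, 0 ≤ T → ContinuousOn u (Icc 0 T)) :
    u ∈ L2e E := fun T => by
  rcases le_or_gt 0 T with hT | hT
  · obtain ⟨C, hC⟩ := isCompact_Icc.exists_bound_of_continuousOn (hu T hT)
    exact MemLp.of_bound ((hu T hT).aestronglyMeasurable_of_isCompact isCompact_Icc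
      measurableSet_Icc) C ((ae_restrict_iff' measurableSet_Icc).2 (Eventually.of_forall hC))
  · simp [Icc_eq_empty hT.not_ge]

/-- A signal in `L₂ₑ` with bounded energy is in `L₂`. -/
theorem L2e.mem_L2 {u : ℝ → E} (hu : u ∈ L2e E) {C : ℝ}
    (hC : ∀ T, 0 ≤ T → ∫ t in (0 : ℝ)..T, ‖u t‖ ^ 2 ≤ C) : u ∈ L2 E := by
  have hunion : Ici (0 : ℝ) = ⋃ n : ℕ, Icc (0 : ℝ) n := by
    ext t
    simp only [mem_Ici, mem_iUnion, mem_Icc]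
    exact ⟨fun h => (exists_nat_ge t).imp fun n hn => ⟨h, hn⟩, fun ⟨_, h⟩ => h.1⟩
  have hm : AEStronglyMeasurable u (volume.restrict (Ici 0)) := by
    rw [hunion, aestronglyMeasurable_iUnion_iff]
    exact fun n => (hu n).1
  refine (memLp_two_iff_integrable_sq_norm hm).2 ?_
  rw [← IntegrableOn, integrableOn_Ici_iff_integrableOn_Ioi]
  refine integrableOn_Ioi_of_intervalIntegral_norm_bounded (l := atTop) (b := id) C 0
    (fun T => ?_) tendsto_id ?_
  · rcases le_or_gt 0 T with hT | hT
    · exact (intervalIntegrable_iff_integrableOn_Ioc_of_le hT).1 (L2e.intervalIntegrable_norm_sq hu hT)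
    · simp [Ioc_eq_empty hT.le.not_gt]
  · filter_upwards [eventually_ge_atTop 0] with T hT
    simpa using hC T hT

theorem L2.mem_L2e {u : ℝ → E} (hu : u ∈ L2 E) : u ∈ L2e E :=
  fun _ => MemLp.mono_measure (Measure.restrict_mono Icc_subset_Ici_self le_rfl) hu

theorem L2.integral_norm_sq_le {u : ℝ → E} (hu : u ∈ L2 E) {T : ℝ} (hT : 0 ≤ T) :
    ∫ t in (0 : ℝ)..T, ‖u t‖ ^ 2 ≤ ∫ t in Ici 0, ‖u t‖ ^ 2 := by
  rw [intervalIntegral.integral_of_le hT]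
  exact setIntegral_mono_set ((memLp_two_iff_integrable_sq_norm hu.1).1 hu)
    (Eventually.of_forall fun _ => by positivity)
    (Ioc_subset_Icc_self.trans Icc_subset_Ici_self).eventuallyLE

variable [NormedSpace ℝ E] [NormedSpace ℝ F]

theorem L2e.const_smul {u : ℝ → E} (hu : u ∈ L2e E) (c : ℝ) : c • u ∈ L2e E :=
  fun T => (hu T).const_smul c

theorem L2e.clm {u : ℝ → E} (hu : u ∈ L2e E) (A : E →L[ℝ] F) : (fun t => A (u t)) ∈ L2e F :=
  fun T => A.comp_memLp' (hu T)

theorem L2e.stack {d : ℕ} {u v : ℝ → Vec d} (hu : u ∈ L2e (Vec d)) (hv : v ∈ L2e (Vec d)) :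
    (fun t => stack (u t) (v t)) ∈ L2e (Vec2 d) := by
  have h := L2e.add (L2e.clm hu ((stackL d).comp (ContinuousLinearMap.inl ℝ (Vec d) (Vec d))))
    (L2e.clm hv ((stackL d).comp (ContinuousLinearMap.inr ℝ (Vec d) (Vec d))))
  convert! h using 1
  funext t
  ext (i | i) <;> simp [MirrorDescent.stack]

end Signals

/-! ### First order linear systems with integrable input -/

section FirstOrder

variable {E : Type*} [NormedAddCommGroup E] [NormedSpace ℝ E]

/-- The response `t ↦ ∫₀ᵗ exp(-α (t - s)) b(s) ds` of the first order system `ẏ = -α y + b` with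
zero initial state. -/
noncomputable def expConv (α : ℝ) (b : ℝ → E) (t : ℝ) : E :=
  ∫ s in (0 : ℝ)..t, Real.exp (-(α * (t - s))) • b s

variable {α : ℝ} {b : ℝ → E} {T : ℝ}

theorem expConv_eq (α : ℝ) (b : ℝ → E) :
    expConv α b = (fun t => Real.exp (-(α * t))) •
      fun t => ∫ s in (0 : ℝ)..t, Real.exp (α * s) • b s := by
  funext t
  rw [Pi.smul_apply', ← intervalIntegral.integral_smul]
  refine intervalIntegral.integral_congr fun s _ => ?_
  rw [smul_smul, ← Real.exp_add]
  ring_nf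

theorem intervalIntegrable_exp_smul (hb : IntervalIntegrable b volume 0 T) :
    IntervalIntegrable (fun s => Real.exp (α * s) • b s) volume 0 T :=
  hb.continuousOn_smul (by fun_prop)

theorem absolutelyContinuousOnInterval_expConv (hT : 0 ≤ T)
    (hb : IntervalIntegrable b volume 0 T) :
    AbsolutelyContinuousOnInterval (expConv α b) 0 T := by
  rw [expConv_eq]
  refine AbsolutelyContinuousOnInterval.smul (ContDiffOn.absolutelyContinuousOnInterval ?_)
    (absolutelyContinuousOnInterval_primitive hT (intervalIntegrable_exp_smul hb))
  fun_prop

theorem continuousOn_expConv (hT : 0 ≤ T) (hb : IntervalIntegrable b volume 0 T) :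
    ContinuousOn (expConv α b) (Icc 0 T) := by
  simpa [uIcc_of_le hT] using (absolutelyContinuousOnInterval_expConv (α := α) hT hb).continuousOn

theorem intervalIntegrable_field (hT : 0 ≤ T) (hb : IntervalIntegrable b volume 0 T) {y : ℝ → E}
    (hy : ContinuousOn y (Icc 0 T)) :
    IntervalIntegrable (fun s => -(α • y s) + b s) volume 0 T :=
  (ContinuousOn.intervalIntegrable (by rw [uIcc_of_le hT]; exact (hy.const_smul α).neg)).add hb

variable [CompleteSpace E]

theorem ae_hasDerivAt_expConv (hb : IntervalIntegrable b volume 0 T) :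
    ∀ᵐ t, t ∈ uIcc 0 T → HasDerivAt (expConv α b) (-(α • expConv α b t) + b t) t := by
  filter_upwards [(intervalIntegrable_exp_smul (α := α) hb).ae_hasDerivAt_integral] with t ht htT
  rw [expConv_eq]
  have h1 : HasDerivAt (fun t => Real.exp (-(α * t))) (Real.exp (-(α * t)) * -(α * 1)) t :=
    ((hasDerivAt_id t).const_mul α).neg.exp
  refine (h1.smul (ht htT 0 left_mem_uIcc)).congr_deriv ?_
  rw [smul_smul, ← Real.exp_add, neg_add_cancel, Real.exp_zero, one_smul, Pi.smul_apply',
    smul_smul, add_comm, ← neg_smul]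
  ring_nf

theorem expConv_eq_integral (hT : 0 ≤ T) (hb : IntervalIntegrable b volume 0 T) :
    expConv α b T = ∫ s in (0 : ℝ)..T, (-(α • expConv α b s) + b s) := by
  rw [← sub_eq_integral_of_absolutelyContinuous hT
    (absolutelyContinuousOnInterval_expConv hT hb)
    (intervalIntegrable_field hT hb (continuousOn_expConv hT hb)) (ae_hasDerivAt_expConv hb)]
  simp [expConv]

/-- Variation of constants: the convolution solves the same integral equation, whose solution is
unique. The Lipschitz constant is `|α|`, enlarged by `1` only to be positive. -/
theorem eq_expConv (hT : 0 ≤ T) (hb : IntervalIntegrable b volume 0 T) {y : ℝ → E}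
    (hy : ContinuousOn y (Icc 0 T))
    (hyb : ∀ t ∈ Icc 0 T, y t = ∫ s in (0 : ℝ)..t, (-(α • y s) + b s)) :
    ∀ t ∈ Icc 0 T, y t = expConv α b t := by
  have hsub : ∀ t ∈ Icc 0 T, IntervalIntegrable b volume 0 t := fun t ht =>
    hb.mono_set (by rw [uIcc_of_le hT, uIcc_of_le ht.1]; exact Icc_subset_Icc_right ht.2)
  refine eq_of_integral_eq (K := |α| + 1) hT (by positivity) hy (continuousOn_expConv hT hb)
    (intervalIntegrable_field hT hb hy)
    (intervalIntegrable_field hT hb (continuousOn_expConv hT hb)) hyb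
    (fun t ht => expConv_eq_integral ht.1 (hsub t ht)) (Eventually.of_forall fun t => ?_)
  rw [add_sub_add_right_eq_sub, neg_sub_neg, ← smul_sub, norm_smul, Real.norm_eq_abs,
    norm_sub_rev]
  gcongr
  linarith

end FirstOrder

/-! ### State-space form and causality of the linear operator -/

section Operator

variable {d : ℕ} {η μf μc : ℝ}

/-- The forcing term `B w` of the state equation of `mdOperator`. -/
noncomputable def mdInput {d : ℕ} (η μf : ℝ) (w : ℝ → Vec2 d) (t : ℝ) : Vec d :=
  (-η) • upper (w t) + (-(η * μf)) • lower (w t)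

/-- The state of `mdOperator`. -/
noncomputable def mdState {d : ℕ} (η μf μc : ℝ) (w : ℝ → Vec2 d) : ℝ → Vec d :=
  expConv (η * μf * μc) (mdInput η μf w)

theorem mdInput_mem {w : ℝ → Vec2 d} (hw : w ∈ L2e (Vec2 d)) : mdInput η μf w ∈ L2e (Vec d) :=
  L2e.clm hw ((-η) • upperL d + (-(η * μf)) • lowerL d)

theorem exp_smul_matA (r : ℝ) :
    NormedSpace.exp (r • matA d η μf μc) = Real.exp (-(η * μf * μc * r)) • 1 := by
  rw [matA, smul_smul, Matrix.smul_one_eq_diagonal, Matrix.exp_diagonal,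
    Matrix.smul_one_eq_diagonal]
  congr 1
  funext i
  rw [Pi.coe_exp, Real.exp_eq_exp_ℝ]
  ring_nf

theorem mdOperator_apply {w : ℝ → Vec2 d} (hw : w ∈ L2e (Vec2 d)) {t : ℝ} (ht : 0 ≤ t) :
    mdOperator d η μf μc w t =
      stack (μc • mdState η μf μc w t + lower (w t)) (mdState η μf μc w t) := by
  let A : Vec d →L[ℝ] (Fin d ⊕ Fin d → ℝ) :=
    (PiLp.continuousLinearEquiv 2 ℝ (fun _ : Fin d ⊕ Fin d => ℝ)).toContinuousLinearMap.comp
      ((stackL d).comp ((μc • ContinuousLinearMap.id ℝ (Vec d)).prod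
        (ContinuousLinearMap.id ℝ (Vec d))))
  have hA : ∀ s, (matC d μc * NormedSpace.exp ((t - s) • matA d η μf μc) *
      matB d η μf).mulVec (w s).ofLp =
      A (Real.exp (-(η * μf * μc * (t - s))) • mdInput η μf w s) := fun s => by
    rw [exp_smul_matA, Matrix.mul_smul, Matrix.mul_one, Matrix.smul_mul, Matrix.smul_mulVec,
      map_smul, ← Matrix.mulVec_mulVec, matB, matC]
    congr 1
    funext i
    rcases i with i | i <;>
      simp [A, stack, mdInput, upper, lower, Matrix.fromRows_mulVec, Matrix.fromCols_mulVec,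
        Matrix.smul_mulVec, Matrix.neg_mulVec, Function.comp_def]
  have hint : IntervalIntegrable (fun s => Real.exp (-(η * μf * μc * (t - s))) • mdInput η μf w s)
      volume 0 t :=
    (L2e.intervalIntegrable (mdInput_mem hw) ht).continuousOn_smul (by fun_prop)
  unfold mdOperator ltiOperator
  simp_rw [hA]
  rw [A.intervalIntegral_comp_comm hint]
  ext (i | i) <;>
    simp [A, stack, mdState, expConv, lower, matD, Matrix.mulVec, Matrix.fromBlocks,
      dotProduct, Fintype.sum_sum_type, Matrix.one_apply]

theorem continuousOn_mdState {w : ℝ → Vec2 d} (hw : w ∈ L2e (Vec2 d)) {T : ℝ} (hT : 0 ≤ T) :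
    ContinuousOn (mdState η μf μc w) (Icc 0 T) :=
  continuousOn_expConv hT (L2e.intervalIntegrable (mdInput_mem hw) hT)

theorem isCausal_mdOperator : IsCausal (mdOperator d η μf μc) := by
  have hG : ∀ w ∈ L2e (Vec2 d), (fun t => stack (μc • mdState η μf μc w t + lower (w t))
      (mdState η μf μc w t)) =ᵐ[volume.restrict (Ici 0)] mdOperator d η μf μc w := fun w hw =>
    (ae_restrict_iff' measurableSet_Ici).2
      (Eventually.of_forall fun t ht => (mdOperator_apply hw ht).symm)
  refine ⟨fun w hw => ?_, fun T hT w hw w' hw' h => ?_⟩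
  · have hs : mdState η μf μc w ∈ L2e (Vec d) :=
      L2e.of_continuousOn fun T hT => continuousOn_mdState hw hT
    exact L2e.congr (L2e.stack (L2e.add (L2e.const_smul hs μc) (L2e.clm hw (lowerL d))) hs) (hG w hw)
  · have hae := (ae_restrict_iff' measurableSet_Icc).1 h
    have hst : ∀ t ∈ Icc 0 T, mdState η μf μc w t = mdState η μf μc w' t := fun t ht => by
      refine intervalIntegral.integral_congr_ae ?_
      filter_upwards [hae] with s hs hst
      rw [uIoc_of_le ht.1] at hst
      simp only [mdInput, hs ⟨hst.1.le, hst.2.trans ht.2⟩]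
    refine (ae_restrict_iff' measurableSet_Icc).2 ?_
    filter_upwards [hae] with t h1 ht
    rw [mdOperator_apply hw ht.1, mdOperator_apply hw' ht.1, h1 ht, hst t ht]

end Operator

/-! ### The algebraic loop and the closed-loop vector field -/

section ClosedLoop

variable {d : ℕ}

/-- The pointwise nonlinearity `v ↦ (F₁ v₁ - μf v₁, F₂ v₂ - μc v₂)`. -/
def loopNonlinearity (F₁ F₂ : Vec d → Vec d) (μf μc : ℝ) (v : Vec2 d) : Vec2 d :=
  stack (F₁ (upper v) - μf • upper v) (F₂ (lower v) - μc • lower v)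

/-- The signal `v` of the interconnection in terms of the inputs `g`, `e` and the state `y`. -/
def loopV (F₂ : Vec d → Vec d) (μc : ℝ) (g e : Vec2 d) (y : Vec d) : Vec2 d :=
  stack (F₂ (y + lower g) + (lower e + upper g + (-μc) • lower g)) (y + lower g)

/-- The signal `w` of the interconnection in terms of the inputs `g`, `e` and the state `y`. -/
def loopW (F₁ F₂ : Vec d → Vec d) (μf μc : ℝ) (g e : Vec2 d) (y : Vec d) : Vec2 d :=
  loopNonlinearity F₁ F₂ μf μc (loopV F₂ μc g e y) + e

/-- The vector field of the state of the interconnection. -/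
def loopField (F₁ F₂ : Vec d → Vec d) (η μf μc : ℝ) (g e : Vec2 d) (y : Vec d) : Vec d :=
  (-η) • F₁ (upper (loopV F₂ μc g e y)) + (η * μf) • upper g + (-η) • upper e

variable {F₁ F₂ : Vec d → Vec d} {η μf μc L₁ L₂ : ℝ}

theorem loopV_eq_stack_add (g e : Vec2 d) (y : Vec d) :
    loopV F₂ μc g e y =
      stack (μc • y + lower (loopW F₁ F₂ μf μc g e y)) y + g := by
  rw [← stack_upper_lower (stack _ y + g)]
  simp only [upper_add, lower_add, upper_stack, lower_stack, loopW, loopNonlinearity, loopV]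
  congr 1
  module

/-- Solved by back substitution: `lower v` does not involve `w`, it determines `lower w`, and that
determines `upper v`. -/
theorem eq_loopV {g e v w : Vec2 d} {y : Vec d} (hv : v = stack (μc • y + lower w) y + g)
    (hw : w = loopNonlinearity F₁ F₂ μf μc v + e) : v = loopV F₂ μc g e y := by
  have hl : lower v = y + lower g := by rw [hv]; simp
  have hlw : lower w = F₂ (y + lower g) - μc • (y + lower g) + lower e := by
    rw [hw, lower_add, ← hl]; rfl
  have hu : upper v = μc • y + lower w + upper g := by rw [hv]; simp
  rw [← stack_upper_lower v, hl, hu, hlw, loopV]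
  congr 1
  module

/-- Since `upper v = μc • y + lower w + upper g`, the term `η μf • upper v` hidden in `-η • upper w`
cancels both the decay `-η μf μc • y` and the input `-η μf • lower w`. -/
theorem field_loopW (g e : Vec2 d) (y : Vec d) :
    -((η * μf * μc) • y) + ((-η) • upper (loopW F₁ F₂ μf μc g e y)
      + (-(η * μf)) • lower (loopW F₁ F₂ μf μc g e y)) = loopField F₁ F₂ η μf μc g e y := by
  simp only [upper_add, lower_add, upper_stack, lower_stack, loopW, loopNonlinearity, loopV,
    loopField]
  module

theorem norm_upper_le (v : Vec2 d) : ‖upper v‖ ≤ ‖v‖ :=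
  abs_le_of_sq_le_sq' (by rw [norm_sq_eq_upper_lower v]; nlinarith [sq_nonneg ‖lower v‖])
    (norm_nonneg _) |>.2

theorem norm_lower_le (v : Vec2 d) : ‖lower v‖ ≤ ‖v‖ :=
  abs_le_of_sq_le_sq' (by rw [norm_sq_eq_upper_lower v]; nlinarith [sq_nonneg ‖upper v‖])
    (norm_nonneg _) |>.2

theorem norm_stack_le (a b : Vec d) : ‖stack a b‖ ≤ ‖a‖ + ‖b‖ :=
  abs_le_of_sq_le_sq' (by
    rw [norm_sq_eq_upper_lower, upper_stack, lower_stack]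
    nlinarith [norm_nonneg a, norm_nonneg b]) (by positivity) |>.2

section Lipschitz

variable (h₁ : ∀ x y, ‖F₁ x - F₁ y‖ ≤ L₁ * ‖x - y‖) (h₂ : ∀ x y, ‖F₂ x - F₂ y‖ ≤ L₂ * ‖x - y‖)
  (hL₁ : 0 ≤ L₁) (hL₂ : 0 ≤ L₂)

include h₁ h₂ hL₁ hL₂ in
theorem norm_loopNonlinearity_sub_le (v v' : Vec2 d) :
    ‖loopNonlinearity F₁ F₂ μf μc v - loopNonlinearity F₁ F₂ μf μc v'‖
      ≤ (L₁ + |μf| + (L₂ + |μc|)) * ‖v - v'‖ := by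
  have hlip : ∀ {F : Vec d → Vec d} {L : ℝ}, (∀ x y, ‖F x - F y‖ ≤ L * ‖x - y‖) →
      ∀ (μ : ℝ) (x y : Vec d), ‖F x - μ • x - (F y - μ • y)‖ ≤ (L + |μ|) * ‖x - y‖ :=
    fun {F L} hF μ x y => by
      have e1 : F x - μ • x - (F y - μ • y) = (F x - F y) - μ • (x - y) := by module
      rw [e1, add_mul]
      refine (norm_sub_le _ _).trans (add_le_add (hF x y) ?_)
      rw [norm_smul, Real.norm_eq_abs]
  have e2 : loopNonlinearity F₁ F₂ μf μc v - loopNonlinearity F₁ F₂ μf μc v' =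
      stack (F₁ (upper v) - μf • upper v - (F₁ (upper v') - μf • upper v'))
        (F₂ (lower v) - μc • lower v - (F₂ (lower v') - μc • lower v')) := by
    ext (i | i) <;> rfl
  rw [e2, add_mul]
  refine (norm_stack_le _ _).trans (add_le_add ?_ ?_)
  · exact (hlip h₁ μf _ _).trans
      (mul_le_mul_of_nonneg_left (norm_upper_le (v - v')) (by positivity))
  · exact (hlip h₂ μc _ _).trans
      (mul_le_mul_of_nonneg_left (norm_lower_le (v - v')) (by positivity))

theorem loopNonlinearity_zero (h₁₀ : F₁ 0 = 0) (h₂₀ : F₂ 0 = 0) :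
    loopNonlinearity F₁ F₂ μf μc 0 = 0 := by
  have hu : upper (0 : Vec2 d) = 0 := rfl
  have hl : lower (0 : Vec2 d) = 0 := rfl
  ext (i | i) <;> simp [loopNonlinearity, hu, hl, h₁₀, h₂₀, stack]

include h₁ h₂ hL₁ in
theorem norm_loopField_sub_le (hη : 0 ≤ η) (g e : Vec2 d) (x y : Vec d) :
    ‖loopField F₁ F₂ η μf μc g e x - loopField F₁ F₂ η μf μc g e y‖
      ≤ η * L₁ * L₂ * ‖x - y‖ := by
  have e1 : loopField F₁ F₂ η μf μc g e x - loopField F₁ F₂ η μf μc g e y = (-η) •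
      (F₁ (upper (loopV F₂ μc g e x)) - F₁ (upper (loopV F₂ μc g e y))) := by
    simp only [loopField]; module
  rw [e1, norm_smul, norm_neg, Real.norm_of_nonneg hη, mul_assoc, mul_assoc]
  refine mul_le_mul_of_nonneg_left ((h₁ _ _).trans (mul_le_mul_of_nonneg_left ?_ hL₁)) hη
  simpa [loopV] using h₂ (x + lower g) (y + lower g)

include h₂ in
theorem loopV_mem_L2e (h₂₀ : F₂ 0 = 0) {g e : ℝ → Vec2 d} {y : ℝ → Vec d}
    (hg : g ∈ L2e (Vec2 d)) (he : e ∈ L2e (Vec2 d)) (hy : y ∈ L2e (Vec d)) :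
    (fun t => loopV F₂ μc (g t) (e t) (y t)) ∈ L2e (Vec2 d) := by
  have hgl := L2e.clm hg (lowerL d)
  have hyg := L2e.add hy hgl
  exact L2e.stack (L2e.add (L2e.of_lipschitz hyg h₂ h₂₀)
    (L2e.add (L2e.add (L2e.clm he (lowerL d)) (L2e.clm hg (upperL d)))
      (L2e.const_smul hgl (-μc)))) hyg

include h₁ h₂ in
theorem loopField_mem_L2e (h₁₀ : F₁ 0 = 0) (h₂₀ : F₂ 0 = 0) {g e : ℝ → Vec2 d} {y : ℝ → Vec d}
    (hg : g ∈ L2e (Vec2 d)) (he : e ∈ L2e (Vec2 d)) (hy : y ∈ L2e (Vec d)) :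
    (fun t => loopField F₁ F₂ η μf μc (g t) (e t) (y t)) ∈ L2e (Vec d) := by
  have hV := L2e.clm (loopV_mem_L2e (μc := μc) h₂ h₂₀ hg he hy) (upperL d)
  exact L2e.add (L2e.add (L2e.const_smul (L2e.of_lipschitz hV h₁ h₁₀) (-η))
    (L2e.const_smul (L2e.clm hg (upperL d)) (η * μf)))
    (L2e.const_smul (L2e.clm he (upperL d)) (-η))

include h₁ h₂ hL₁ hL₂ in
theorem loopW_mem_L2e (h₁₀ : F₁ 0 = 0) (h₂₀ : F₂ 0 = 0) {g e : ℝ → Vec2 d} {y : ℝ → Vec d}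
    (hg : g ∈ L2e (Vec2 d)) (he : e ∈ L2e (Vec2 d)) (hy : y ∈ L2e (Vec d)) :
    (fun t => loopW F₁ F₂ μf μc (g t) (e t) (y t)) ∈ L2e (Vec2 d) :=
  L2e.add (L2e.of_lipschitz (loopV_mem_L2e (μc := μc) h₂ h₂₀ hg he hy)
    (norm_loopNonlinearity_sub_le (μf := μf) (μc := μc) h₁ h₂ hL₁ hL₂)
    (loopNonlinearity_zero h₁₀ h₂₀)) he

include h₁ h₂ hL₁ hL₂ in
/-- Dissipation inequality for the field of the interconnection. -/
theorem exists_inner_loopField_le (hη : 0 < η) (hμf : 0 < μf)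
    (hm : ∀ x, μf * ‖x‖ ^ 2 ≤ inner ℝ (F₁ x) x) :
    ∃ C, 0 ≤ C ∧ ∀ (g e : Vec2 d) (y : Vec d),
      inner ℝ (F₂ y) (loopField F₁ F₂ η μf μc g e y) ≤
        -(η * μf / 2) * ‖F₂ y‖ ^ 2 + C * (‖g‖ ^ 2 + ‖e‖ ^ 2) := by
  -- `R (‖g‖ + ‖e‖)` bounds the deviation `r` of the field from the unforced `-η F₁(F₂ y)`. Young's
  -- inequality spends half of the dissipation `η μf ‖F₂ y‖²` on it.
  set R := η * (L₁ * (L₂ + 1 + |μc|) + μf + 1) with hR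
  have hR0 : 0 ≤ R := by positivity
  refine ⟨R ^ 2 / (η * μf), by positivity, fun g e y => ?_⟩
  set r := loopField F₁ F₂ η μf μc g e y + η • F₁ (F₂ y) with hr
  have hgl := norm_lower_le g
  have hgu := norm_upper_le g
  have hel := norm_lower_le e
  have heu := norm_upper_le e
  have h3 : ‖F₁ (upper (loopV F₂ μc g e y)) - F₁ (F₂ y)‖
      ≤ L₁ * ((L₂ + 1 + |μc|) * (‖g‖ + ‖e‖)) := by
    refine (h₁ _ _).trans (mul_le_mul_of_nonneg_left ?_ hL₁)
    have e1 : upper (loopV F₂ μc g e y) - F₂ y = (F₂ (y + lower g) - F₂ y) + lower e + upper g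
        + (-μc) • lower g := by
      simp only [loopV, upper_stack]; abel
    rw [e1]
    refine (norm_add_le _ _).trans ?_
    rw [norm_smul, norm_neg, Real.norm_eq_abs]
    have h4 : ‖F₂ (y + lower g) - F₂ y‖ ≤ L₂ * ‖lower g‖ := by simpa using h₂ (y + lower g) y
    have h5 := norm_add₃_le (a := F₂ (y + lower g) - F₂ y) (b := lower e) (c := upper g)
    have h6 := mul_le_mul_of_nonneg_left hgl hL₂
    have h7 := mul_le_mul_of_nonneg_left hgl (abs_nonneg μc)
    have h8 := mul_nonneg hL₂ (norm_nonneg e)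
    have h9 := mul_nonneg (abs_nonneg μc) (norm_nonneg e)
    linarith
  have hrn : ‖r‖ ≤ R * (‖g‖ + ‖e‖) := by
    have e2 : r = (-η) • (F₁ (upper (loopV F₂ μc g e y)) - F₁ (F₂ y)) + (η * μf) • upper g
        + (-η) • upper e := by
      simp only [hr, loopField]; module
    rw [e2]
    refine (norm_add₃_le).trans ?_
    simp only [norm_smul, norm_neg, norm_mul, Real.norm_of_nonneg hη.le, Real.norm_of_nonneg hμf.le]
    have h6 := mul_le_mul_of_nonneg_left h3 hη.le
    have h7 := mul_le_mul_of_nonneg_left hgu (mul_pos hη hμf).le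
    have h8 := mul_le_mul_of_nonneg_left heu hη.le
    have h9 := mul_nonneg (mul_pos hη hμf).le (norm_nonneg e)
    have h10 := mul_nonneg hη.le (norm_nonneg g)
    rw [hR]
    linarith
  have e3 : loopField F₁ F₂ η μf μc g e y = r - η • F₁ (F₂ y) := by simp [hr]
  rw [e3, inner_sub_right, inner_smul_right, real_inner_comm (F₁ (F₂ y))]
  have h4 := mul_le_mul_of_nonneg_left (hm (F₂ y)) hη.le
  have h5 := (real_inner_le_norm (F₂ y) r).trans
    (mul_le_mul_of_nonneg_left hrn (norm_nonneg (F₂ y)))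
  have h6 : ‖F₂ y‖ * (R * (‖g‖ + ‖e‖)) ≤
      η * μf / 2 * ‖F₂ y‖ ^ 2 + R ^ 2 / (η * μf) * (‖g‖ ^ 2 + ‖e‖ ^ 2) := by
    have hc : 0 < η * μf := by positivity
    have h7 : (‖g‖ + ‖e‖) ^ 2 ≤ 2 * (‖g‖ ^ 2 + ‖e‖ ^ 2) := by nlinarith [sq_nonneg (‖g‖ - ‖e‖)]
    have h8 : 0 ≤ (η * μf * ‖F₂ y‖ - R * (‖g‖ + ‖e‖)) ^ 2 := sq_nonneg _
    have h9 : ‖F₂ y‖ * (R * (‖g‖ + ‖e‖)) ≤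
        η * μf / 2 * ‖F₂ y‖ ^ 2 + R ^ 2 / (η * μf) * ((‖g‖ + ‖e‖) ^ 2 / 2) := by
      have h10 : R ^ 2 / (η * μf) * ((‖g‖ + ‖e‖) ^ 2 / 2) =
        (R * (‖g‖ + ‖e‖)) ^ 2 / (2 * (η * μf)) := by field_simp
      rw [h10, ← sub_le_iff_le_add', le_div_iff₀ (by positivity)]
      nlinarith
    refine h9.trans ?_
    gcongr
    linarith
  linarith

include h₁ h₂ hL₁ hL₂ in
/-- The signals of the interconnection are bounded by the inputs and `F₂` of the state. -/
theorem exists_norm_loop_le (hμc : 0 < μc) (h₁₀ : F₁ 0 = 0) (h₂₀ : F₂ 0 = 0)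
    (hF₂ : ∀ y, μc * ‖y‖ ≤ ‖F₂ y‖) :
    ∃ C, 0 < C ∧ ∀ (g e : Vec2 d) (y : Vec d),
      ‖loopV F₂ μc g e y‖ ^ 2 + ‖loopW F₁ F₂ μf μc g e y‖ ^ 2 ≤
        C * (‖F₂ y‖ ^ 2 + (‖g‖ ^ 2 + ‖e‖ ^ 2)) := by
  set A := 1 + μc⁻¹ + L₂ + 1 + μc + 1 with hA
  set B := L₁ + |μf| + (L₂ + |μc|) with hB
  have hA0 : 0 < A := by positivity
  have hB0 : 0 ≤ B := by positivity
  -- The factor `3` comes from squaring a sum of three norms; `A` is a crude sum of the coefficients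
  -- in the bound on `v`, and `B` is the Lipschitz constant of the nonlinearity.
  refine ⟨3 * (A ^ 2 + (B * A + 1) ^ 2), by positivity, fun g e y => ?_⟩
  set S := ‖F₂ y‖ + ‖g‖ + ‖e‖ with hS
  have hgl := norm_lower_le g
  have hgu := norm_upper_le g
  have hel := norm_lower_le e
  have hV : ‖loopV F₂ μc g e y‖ ≤ A * S := by
    have hy : ‖y‖ ≤ μc⁻¹ * ‖F₂ y‖ := by
      rw [inv_mul_eq_div, le_div_iff₀ hμc, mul_comm]; exact hF₂ y
    have h3 : ‖F₂ (y + lower g)‖ ≤ ‖F₂ y‖ + L₂ * ‖g‖ := by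
      have h4 : ‖F₂ (y + lower g) - F₂ y‖ ≤ L₂ * ‖lower g‖ := by simpa using h₂ (y + lower g) y
      have h5 := norm_le_norm_sub_add (F₂ (y + lower g)) (F₂ y)
      have h6 := mul_le_mul_of_nonneg_left hgl hL₂
      linarith
    have h4 : ‖y + lower g‖ ≤ μc⁻¹ * ‖F₂ y‖ + ‖g‖ := (norm_add_le _ _).trans (add_le_add hy hgl)
    have h5 : ‖lower e + upper g + (-μc) • lower g‖ ≤ ‖e‖ + ‖g‖ + μc * ‖g‖ := by
      refine norm_add₃_le.trans ?_
      rw [norm_smul, norm_neg, Real.norm_of_nonneg hμc.le]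
      gcongr
    have h6 := norm_stack_le (F₂ (y + lower g) + (lower e + upper g + (-μc) • lower g))
      (y + lower g)
    have h7 := norm_add_le (F₂ (y + lower g)) (lower e + upper g + (-μc) • lower g)
    have p1 := mul_nonneg hL₂ (norm_nonneg (F₂ y))
    have p2 := mul_nonneg hL₂ (norm_nonneg e)
    have p3 := mul_nonneg hμc.le (norm_nonneg (F₂ y))
    have p4 := mul_nonneg hμc.le (norm_nonneg e)
    have p5 := mul_nonneg (inv_pos.2 hμc).le (norm_nonneg g)
    have p6 := mul_nonneg (inv_pos.2 hμc).le (norm_nonneg e)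
    have p7 := norm_nonneg (F₂ y)
    have p8 := norm_nonneg e
    have p9 := norm_nonneg g
    rw [loopV, hA, hS]
    linarith
  have hW : ‖loopW F₁ F₂ μf μc g e y‖ ≤ (B * A + 1) * S := by
    have h3 := norm_loopNonlinearity_sub_le (μf := μf) (μc := μc) h₁ h₂ hL₁ hL₂
      (loopV F₂ μc g e y) 0
    rw [loopNonlinearity_zero h₁₀ h₂₀, sub_zero, sub_zero] at h3
    have h4 := mul_le_mul_of_nonneg_left hV hB0
    have h5 := norm_add_le (loopNonlinearity F₁ F₂ μf μc (loopV F₂ μc g e y)) e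
    have h6 : ‖e‖ ≤ S := by rw [hS]; linarith [norm_nonneg (F₂ y), norm_nonneg g]
    rw [loopW]
    linarith
  have hS2 : S ^ 2 ≤ 3 * (‖F₂ y‖ ^ 2 + (‖g‖ ^ 2 + ‖e‖ ^ 2)) := by
    rw [hS]
    nlinarith [sq_nonneg (‖F₂ y‖ - ‖g‖), sq_nonneg (‖F₂ y‖ - ‖e‖), sq_nonneg (‖g‖ - ‖e‖)]
  have hV2 := pow_le_pow_left₀ (norm_nonneg _) hV 2
  have hW2 := pow_le_pow_left₀ (norm_nonneg _) hW 2
  rw [mul_pow] at hV2 hW2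
  have := mul_le_mul_of_nonneg_left hS2 (by positivity : 0 ≤ A ^ 2 + (B * A + 1) ^ 2)
  linarith

end Lipschitz

end ClosedLoop

/-! ### Chain rule along absolutely continuous curves -/

section ChainRule

variable {E : Type*} [NormedAddCommGroup E] [InnerProductSpace ℝ E] [ProperSpace E]

/-- Chain rule for a `C¹` function along a primitive of an integrable function. -/
theorem sub_eq_integral_inner_gradient {h : E → ℝ} {h' : E → E} {u b : ℝ → E} {T : ℝ}
    (hT : 0 ≤ T) (hd : ∀ x, HasGradientAt h (h' x) x) (hc : Continuous h')
    (hb : IntervalIntegrable b volume 0 T)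
    (hu : ∀ t ∈ Icc 0 T, u t = ∫ s in (0 : ℝ)..t, b s) :
    h (u T) - h (u 0) = ∫ s in (0 : ℝ)..T, inner ℝ (h' (u s)) (b s) := by
  -- Outside `[0, T]` nothing ties `u` to `b`, so derivatives, also at the endpoints, are taken of
  -- the primitive. It stays in a ball on which `h` is Lipschitz, so `h ∘ p` is absolutely
  -- continuous.
  let p : ℝ → E := fun t => ∫ s in (0 : ℝ)..t, b s
  have hp : AbsolutelyContinuousOnInterval p 0 T := absolutelyContinuousOnInterval_primitive hT hb
  have hpc : ContinuousOn p (Icc 0 T) := by simpa [uIcc_of_le hT] using hp.continuousOn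
  obtain ⟨R, hR⟩ := isCompact_Icc.exists_bound_of_continuousOn hpc
  obtain ⟨C, hC⟩ := (isCompact_closedBall (0 : E) R).exists_bound_of_continuousOn hc.continuousOn
  have hac : AbsolutelyContinuousOnInterval (fun t => h (p t)) 0 T := by
    refine absolutelyContinuousOnInterval_of_dist_le (K := C) hp fun x hx y hy => ?_
    rw [uIcc_of_le hT] at hx hy
    rw [dist_eq_norm, dist_eq_norm]
    refine (convex_closedBall (0 : E) R).norm_image_sub_le_of_norm_hasFDerivWithin_le
      (fun z _ => (hd z).hasFDerivAt.hasFDerivWithinAt) (fun z hz => ?_) ?_ ?_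
    · rw [LinearIsometryEquiv.norm_map]
      exact hC z hz
    · simpa using hR y hy
    · simpa using hR x hx
  have hint : IntervalIntegrable (fun s => inner ℝ (h' (p s)) (b s)) volume 0 T := by
    rw [intervalIntegrable_iff_integrableOn_Icc_of_le hT] at hb ⊢
    have hm : AEStronglyMeasurable (fun s => h' (p s)) (volume.restrict (Icc 0 T)) :=
      (hc.comp_continuousOn hpc).aestronglyMeasurable_of_isCompact isCompact_Icc measurableSet_Icc
    refine (hb.norm.const_mul C).mono' (hm.inner hb.1)
      ((ae_restrict_iff' measurableSet_Icc).2 (Eventually.of_forall fun s hs => ?_))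
    refine (norm_inner_le_norm _ _).trans (mul_le_mul_of_nonneg_right (hC _ ?_) (norm_nonneg _))
    simpa using hR s hs
  have hmain := sub_eq_integral_of_absolutelyContinuous hT hac hint (by
    filter_upwards [hb.ae_hasDerivAt_integral] with t ht htT
    simpa [Function.comp_def] using
      (hd (p t)).hasFDerivAt.comp_hasDerivAt t (ht htT 0 left_mem_uIcc))
  rw [hu T (right_mem_Icc.2 hT), hu 0 (left_mem_Icc.2 hT)]
  refine hmain.trans (intervalIntegral.integral_congr fun s hs => ?_)
  rw [uIcc_of_le hT] at hs
  simp only [hu s hs, p]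

end ChainRule

/-! ### Error coordinates and the Bregman Lyapunov function -/

section ErrorGradient

variable {d : ℕ} {h : Vec d → ℝ} {μ L : ℝ}

/-- The gradient of `h` relative to the point `y`: `x ↦ ∇h (x + y) - ∇h y`. -/
noncomputable def errGrad (h : Vec d → ℝ) (y x : Vec d) : Vec d :=
  gradient h (x + y) - gradient h y

/-- The Bregman distance of `h` at `y`, as a function of the displacement. -/
noncomputable def bregman (h : Vec d → ℝ) (y x : Vec d) : ℝ :=
  h (x + y) - h y - inner ℝ (gradient h y) x

theorem shiftedGradient_eq (h : Vec d → ℝ) (μ : ℝ) (y x : Vec d) :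
    shiftedGradient h μ y x = errGrad h y x - μ • x := by
  simp only [shiftedGradient, errGrad]
  module

theorem mdNonlinearity_eq (f ψ : Vec d → ℝ) (μf μc : ℝ) (y z : Vec d) (v : ℝ → Vec2 d) :
    mdNonlinearity f ψ μf μc y z v =
      fun t => loopNonlinearity (errGrad f y) (errGrad ψ z) μf μc (v t) := by
  funext t
  simp only [mdNonlinearity, shiftedGradient_eq, loopNonlinearity]

@[simp] theorem errGrad_zero (h : Vec d → ℝ) (y : Vec d) : errGrad h y 0 = 0 := by
  simp [errGrad]

@[simp] theorem bregman_zero (h : Vec d → ℝ) (y : Vec d) : bregman h y 0 = 0 := by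
  simp [bregman]

variable (hh : h ∈ classS μ L) (hμ : 0 < μ) (hL : 0 < L) (y : Vec d)

include hh in
theorem le_inner_errGrad (x : Vec d) : μ * ‖x‖ ^ 2 ≤ inner ℝ (errGrad h y x) x := by
  simpa [errGrad] using (hh.2 (x + y) y).1

include hh in
theorem le_norm_errGrad (x : Vec d) : μ * ‖x‖ ≤ ‖errGrad h y x‖ := by
  simpa [errGrad] using le_norm_gradient_sub (fun x y => (hh.2 x y).1) (x + y) y

include hh hμ hL in
theorem norm_errGrad_sub_le (x x' : Vec d) :
    ‖errGrad h y x - errGrad h y x'‖ ≤ L * ‖x - x'‖ := by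
  simpa [errGrad] using classS.norm_gradient_sub_le hh hμ.le hL (x + y) (x' + y)

include hh hμ hL in
theorem continuous_errGrad : Continuous (errGrad h y) :=
  (LipschitzWith.of_dist_le' fun x x' => by
    simpa only [dist_eq_norm] using norm_errGrad_sub_le hh hμ hL y x x').continuous

include hh in
theorem hasGradientAt_bregman (x : Vec d) : HasGradientAt (bregman h y) (errGrad h y x) x := by
  rw [hasGradientAt_iff_hasFDerivAt, errGrad, map_sub]
  have h1 := (classS.hasGradientAt hh (x + y)).hasFDerivAt.comp x
    ((hasFDerivAt_id x).add_const y)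
  exact (h1.sub_const (h y)).sub (InnerProductSpace.toDual ℝ (Vec d) (gradient h y)).hasFDerivAt

include hh hμ in
theorem bregman_nonneg (x : Vec d) : 0 ≤ bregman h y x := by
  have := bregman_ge (classS.hasGradientAt hh) (fun x y => (hh.2 x y).1) y (x + y)
  rw [add_sub_cancel_right] at this
  exact (by positivity : 0 ≤ μ / 2 * ‖x‖ ^ 2).trans this

include hh hμ hL in
theorem norm_errGrad_sq_le (x : Vec d) : ‖errGrad h y x‖ ^ 2 ≤ 2 * L * bregman h y x := by
  have := bregman_ge_norm_gradient_sq hL (classS.hasGradientAt hh) (classS.monotone hh hμ.le)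
    (fun x y => (hh.2 x y).2) y (x + y)
  rw [add_sub_cancel_right, div_le_iff₀ (by positivity)] at this
  rw [errGrad, bregman]
  linarith

include hh hμ in
-- Convexity gives `bregman h y x ≤ ⟪errGrad h y x, x⟫`, and strong monotonicity gives `μ ‖x‖ ≤
-- ‖errGrad h y x‖`. This inequality of Polyak–Łojasiewicz type turns dissipation into exponential
-- decay.
theorem bregman_le_norm_errGrad_sq (x : Vec d) :
    μ * bregman h y x ≤ ‖errGrad h y x‖ ^ 2 := by
  have h1 := bregman_ge (classS.hasGradientAt hh) (fun x y => (hh.2 x y).1) (x + y) y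
  have h2 : 0 ≤ μ / 2 * ‖y - (x + y)‖ ^ 2 := by positivity
  rw [show y - (x + y) = -x by abel, inner_neg_right] at h1
  have h3 : bregman h y x ≤ inner ℝ (errGrad h y x) x := by
    rw [bregman, errGrad, inner_sub_left]
    rw [show y - (x + y) = -x by abel] at h2
    linarith
  have h4 := h3.trans (real_inner_le_norm _ _)
  have h5 := le_norm_errGrad hh y x
  nlinarith [norm_nonneg (errGrad h y x)]

end ErrorGradient

/-! ### Well-posedness and finite gain of the interconnection -/

section Stability

variable {d : ℕ} {η μf L₁ μc L₂ : ℝ} {f ψ : Vec d → ℝ} {y z : Vec d}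

/-- The signals of the interconnection are determined by the inputs and the state of
`mdOperator`, which solves an integral equation. -/
theorem Interconnected.loop {e g v w : ℝ → Vec2 d}
    (hI : Interconnected (mdOperator d η μf μc) (mdNonlinearity f ψ μf μc y z) e g v w) :
    ∀ᵐ t ∂volume.restrict (Ici 0),
      v t = loopV (errGrad ψ z) μc (g t) (e t) (mdState η μf μc w t) ∧
      w t = loopW (errGrad f y) (errGrad ψ z) μf μc (g t) (e t) (mdState η μf μc w t) ∧
      -((η * μf * μc) • mdState η μf μc w t) + mdInput η μf w t =
        loopField (errGrad f y) (errGrad ψ z) η μf μc (g t) (e t) (mdState η μf μc w t) := by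
  filter_upwards [hI.eq_v, hI.eq_w, ae_restrict_mem measurableSet_Ici] with t hv hw ht
  rw [Pi.add_apply, mdOperator_apply hI.mem_w ht] at hv
  rw [Pi.add_apply, mdNonlinearity_eq] at hw
  have h1 := eq_loopV hv hw
  have h2 : w t = loopW (errGrad f y) (errGrad ψ z) μf μc (g t) (e t) (mdState η μf μc w t) := by
    rw [loopW, ← h1, hw]
  refine ⟨h1, h2, ?_⟩
  rw [← field_loopW, ← h2]
  rfl

theorem Interconnected.state_eq {e g v w : ℝ → Vec2 d}
    (hI : Interconnected (mdOperator d η μf μc) (mdNonlinearity f ψ μf μc y z) e g v w)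
    {t : ℝ} (ht : 0 ≤ t) :
    mdState η μf μc w t = ∫ s in (0 : ℝ)..t,
      loopField (errGrad f y) (errGrad ψ z) η μf μc (g s) (e s) (mdState η μf μc w s) := by
  rw [mdState, expConv_eq_integral ht (L2e.intervalIntegrable (mdInput_mem hI.mem_w) ht)]
  refine intervalIntegral.integral_congr_ae ?_
  filter_upwards [(ae_restrict_iff' measurableSet_Ici).1 hI.loop] with s hs hst
  rw [uIoc_of_le ht] at hst
  exact (hs hst.1.le).2.2

theorem mdState_mem_L2e {w : ℝ → Vec2 d} (hw : w ∈ L2e (Vec2 d)) :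
    mdState η μf μc w ∈ L2e (Vec d) :=
  L2e.of_continuousOn fun _ hT => continuousOn_mdState hw hT

variable (hη : 0 < η) (hμf : 0 < μf) (hL₁ : 0 < L₁) (hμc : 0 < μc) (hL₂ : 0 < L₂)
  (hf : f ∈ classS μf L₁) (hψ : ψ ∈ classS μc L₂)

include hμf hL₁ hμc hL₂ hf hψ in
theorem intervalIntegrable_loopField {g e : ℝ → Vec2 d} {x : ℝ → Vec d}
    (hg : g ∈ L2e (Vec2 d)) (he : e ∈ L2e (Vec2 d)) (hx : x ∈ L2e (Vec d)) {T : ℝ} (hT : 0 ≤ T) :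
    IntervalIntegrable (fun t => loopField (errGrad f y) (errGrad ψ z) η μf μc (g t) (e t) (x t))
      volume 0 T :=
  L2e.intervalIntegrable (loopField_mem_L2e (norm_errGrad_sub_le hf hμf hL₁ y)
    (norm_errGrad_sub_le hψ hμc hL₂ z) (errGrad_zero _ _) (errGrad_zero _ _) hg he hx) hT

include hη hμf hL₁ hμc hL₂ hf hψ in
theorem exists_interconnected {e g : ℝ → Vec2 d} (he : e ∈ L2e (Vec2 d)) (hg : g ∈ L2e (Vec2 d)) :
    ∃ v w, Interconnected (mdOperator d η μf μc) (mdNonlinearity f ψ μf μc y z) e g v w := by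
  have h₁ := norm_errGrad_sub_le hf hμf hL₁ y
  have h₂ := norm_errGrad_sub_le hψ hμc hL₂ z
  obtain ⟨x, hxc, hx⟩ := exists_integral_eq (K := η * L₁ * L₂) (by positivity)
    (Φ := fun s => loopField (errGrad f y) (errGrad ψ z) η μf μc (g s) (e s))
    (fun u hu T hT => intervalIntegrable_loopField hμf hL₁ hμc hL₂ hf hψ hg he
      (L2e.of_continuousOn fun _ _ => hu.continuousOn) hT)
    (fun s => norm_loopField_sub_le h₁ h₂ hL₁.le hη.le (g s) (e s))
  have hx2 : x ∈ L2e (Vec d) := L2e.of_continuousOn fun _ _ => hxc.continuousOn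
  set v : ℝ → Vec2 d := fun t => loopV (errGrad ψ z) μc (g t) (e t) (x t) with hv
  set w : ℝ → Vec2 d := fun t => loopW (errGrad f y) (errGrad ψ z) μf μc (g t) (e t) (x t) with hw
  have hwm : w ∈ L2e (Vec2 d) := loopW_mem_L2e h₁ h₂ hL₁.le hL₂.le (errGrad_zero _ _)
    (errGrad_zero _ _) hg he hx2
  -- Closes the loop: the solution of the closed-loop equation is the state that the operator
  -- produces from the signal `w` built from it.
  have hstate : ∀ t, 0 ≤ t → x t = mdState η μf μc w t := fun t ht =>
    eq_expConv ht (L2e.intervalIntegrable (mdInput_mem hwm) ht) hxc.continuousOn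
      (fun s hs => by
        rw [hx s hs.1]
        refine intervalIntegral.integral_congr fun r _ => ?_
        exact (field_loopW (g r) (e r) (x r)).symm) t (right_mem_Icc.2 ht)
  refine ⟨v, w, loopV_mem_L2e h₂ (errGrad_zero _ _) hg he hx2, hwm, ?_, ?_⟩
  · refine (ae_restrict_iff' measurableSet_Ici).2 (Eventually.of_forall fun t ht => ?_)
    rw [Pi.add_apply, mdOperator_apply hwm ht, ← hstate t ht]
    exact loopV_eq_stack_add (g t) (e t) (x t)
  · refine Eventually.of_forall fun t => ?_
    rw [Pi.add_apply, mdNonlinearity_eq]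
    rfl

include hη hμf hL₁ hμc hL₂ hf hψ in
theorem agreeUpTo_of_interconnected {T : ℝ} (hT : 0 ≤ T) {e e' g g' v w v' w' : ℝ → Vec2 d}
    (he : e ∈ L2e (Vec2 d)) (he' : e' ∈ L2e (Vec2 d)) (hg : g ∈ L2e (Vec2 d))
    (hg' : g' ∈ L2e (Vec2 d))
    (hI : Interconnected (mdOperator d η μf μc) (mdNonlinearity f ψ μf μc y z) e g v w)
    (hI' : Interconnected (mdOperator d η μf μc) (mdNonlinearity f ψ μf μc y z) e' g' v' w')
    (hee : AgreeUpTo T e e') (hgg : AgreeUpTo T g g') : AgreeUpTo T v v' ∧ AgreeUpTo T w w' := by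
  have h₁ := norm_errGrad_sub_le hf hμf hL₁ y
  have h₂ := norm_errGrad_sub_le hψ hμc hL₂ z
  have hs := eq_of_integral_eq (K := η * L₁ * L₂) hT (by positivity)
    (continuousOn_mdState hI.mem_w hT) (continuousOn_mdState hI'.mem_w hT)
    (intervalIntegrable_loopField hμf hL₁ hμc hL₂ hf hψ hg he (mdState_mem_L2e hI.mem_w) hT)
    (intervalIntegrable_loopField hμf hL₁ hμc hL₂ hf hψ hg' he' (mdState_mem_L2e hI'.mem_w) hT)
    (fun t ht => hI.state_eq ht.1) (fun t ht => hI'.state_eq ht.1) (by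
      filter_upwards [hee, hgg] with t h1 h2
      rw [h1, h2]
      exact norm_loopField_sub_le h₁ h₂ hL₁.le hη.le _ _ _ _)
  have hl := ae_restrict_of_ae_restrict_of_subset (Icc_subset_Ici_self (a := T) (b := 0)) hI.loop
  have hl' := ae_restrict_of_ae_restrict_of_subset (Icc_subset_Ici_self (a := T) (b := 0)) hI'.loop
  constructor
  · filter_upwards [hl, hl', hee, hgg, ae_restrict_mem measurableSet_Icc] with t a b h1 h2 ht
    rw [a.1, b.1, h1, h2, hs t ht]
  · filter_upwards [hl, hl', hee, hgg, ae_restrict_mem measurableSet_Icc] with t a b h1 h2 ht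
    rw [a.2.1, b.2.1, h1, h2, hs t ht]

include hμf hL₁ hμc hL₂ hf hψ in
theorem isCausal_mdNonlinearity :
    IsCausal (mdNonlinearity f ψ μf μc y z) := by
  refine ⟨fun v hv => ?_, fun T _ v _ v' _ h => ?_⟩
  · rw [mdNonlinearity_eq]
    exact L2e.of_lipschitz hv (norm_loopNonlinearity_sub_le (norm_errGrad_sub_le hf hμf hL₁ y)
      (norm_errGrad_sub_le hψ hμc hL₂ z) hL₁.le hL₂.le)
      (loopNonlinearity_zero (errGrad_zero _ _) (errGrad_zero _ _))
  · filter_upwards [h] with t ht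
    simp only [mdNonlinearity_eq, ht]

include hη hμf hL₁ hμc hL₂ hf hψ in
theorem exists_gain : ∃ c : ℝ, 0 < c ∧ ∀ e ∈ L2e (Vec2 d), ∀ g ∈ L2e (Vec2 d), ∀ v w,
    Interconnected (mdOperator d η μf μc) (mdNonlinearity f ψ μf μc y z) e g v w →
    ∀ T : ℝ, 0 ≤ T → ∫ t in (0 : ℝ)..T, (‖v t‖ ^ 2 + ‖w t‖ ^ 2) ≤
      c * ∫ t in (0 : ℝ)..T, (‖g t‖ ^ 2 + ‖e t‖ ^ 2) := by
  have h₁ := norm_errGrad_sub_le hf hμf hL₁ y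
  have h₂ := norm_errGrad_sub_le hψ hμc hL₂ z
  obtain ⟨C, hC0, hC⟩ := exists_inner_loopField_le (μc := μc) h₁ h₂ hL₁.le hL₂.le hη hμf
    (le_inner_errGrad hf y)
  obtain ⟨B, hB0, hB⟩ := exists_norm_loop_le (μf := μf) h₁ h₂ hL₁.le hL₂.le hμc (errGrad_zero _ _)
    (errGrad_zero _ _) (le_norm_errGrad hψ z)
  set k := η * μf / 2 with hk
  have hk0 : 0 < k := by positivity
  refine ⟨B * (C / k + 1), by positivity, fun e he g hg v w hI T hT => ?_⟩
  set x := mdState η μf μc w with hx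
  have hx2 : x ∈ L2e (Vec d) := mdState_mem_L2e hI.mem_w
  have hF : IntervalIntegrable (fun t => ‖errGrad ψ z (x t)‖ ^ 2) volume 0 T :=
    L2e.intervalIntegrable_norm_sq (L2e.of_lipschitz hx2 h₂ (errGrad_zero _ _)) hT
  have hge : IntervalIntegrable (fun t => ‖g t‖ ^ 2 + ‖e t‖ ^ 2) volume 0 T :=
    (L2e.intervalIntegrable_norm_sq hg hT).add (L2e.intervalIntegrable_norm_sq he hT)
  have hvw : IntervalIntegrable (fun t => ‖v t‖ ^ 2 + ‖w t‖ ^ 2) volume 0 T :=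
    (L2e.intervalIntegrable_norm_sq hI.mem_v hT).add (L2e.intervalIntegrable_norm_sq hI.mem_w hT)
  set b := fun t => loopField (errGrad f y) (errGrad ψ z) η μf μc (g t) (e t) (x t) with hb
  have hb2 : b ∈ L2e (Vec d) :=
    loopField_mem_L2e h₁ h₂ (errGrad_zero _ _) (errGrad_zero _ _) hg he hx2
  have hbi : IntervalIntegrable b volume 0 T := L2e.intervalIntegrable hb2 hT
  have hV := sub_eq_integral_inner_gradient hT (hasGradientAt_bregman hψ z)
    (continuous_errGrad hψ hμc hL₂ z) hbi (fun t ht => hI.state_eq ht.1)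
  -- The state starts at zero, so the energy balance has no initial storage term; the final storage
  -- is nonnegative and is dropped.
  have hx0 : mdState η μf μc w 0 = 0 := by simp [mdState, expConv]
  rw [hx0, bregman_zero, sub_zero] at hV
  have hinner : IntervalIntegrable (fun t => inner ℝ (errGrad ψ z (x t)) (b t)) volume 0 T := by
    have hxc : ContinuousOn (fun t => errGrad ψ z (x t)) (Icc 0 T) :=
      (continuous_errGrad hψ hμc hL₂ z).comp_continuousOn (continuousOn_mdState hI.mem_w hT)
    rw [intervalIntegrable_iff_integrableOn_Icc_of_le hT] at hbi ⊢
    obtain ⟨M, hM⟩ := isCompact_Icc.exists_bound_of_continuousOn hxc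
    refine (hbi.norm.const_mul M).mono' ((hxc.aestronglyMeasurable_of_isCompact isCompact_Icc
      measurableSet_Icc).inner hbi.1)
      ((ae_restrict_iff' measurableSet_Icc).2 (Eventually.of_forall fun s hs => ?_))
    exact (norm_inner_le_norm _ _).trans (mul_le_mul_of_nonneg_right (hM s hs) (norm_nonneg _))
  have hdiss : ∫ t in (0 : ℝ)..T, inner ℝ (errGrad ψ z (x t)) (b t) ≤
      ∫ t in (0 : ℝ)..T, (-k * ‖errGrad ψ z (x t)‖ ^ 2 + C * (‖g t‖ ^ 2 + ‖e t‖ ^ 2)) :=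
    intervalIntegral.integral_mono_on hT hinner ((hF.const_mul _).add (hge.const_mul _))
      fun t _ => hC (g t) (e t) (x t)
  rw [intervalIntegral.integral_add (hF.const_mul _) (hge.const_mul _),
    intervalIntegral.integral_const_mul, intervalIntegral.integral_const_mul] at hdiss
  have hVnn := bregman_nonneg hψ hμc z (x T)
  have hout : ∫ t in (0 : ℝ)..T, (‖v t‖ ^ 2 + ‖w t‖ ^ 2) ≤
      ∫ t in (0 : ℝ)..T, B * (‖errGrad ψ z (x t)‖ ^ 2 + (‖g t‖ ^ 2 + ‖e t‖ ^ 2)) := by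
    refine intervalIntegral.integral_mono_ae_restrict hT hvw ((hF.add hge).const_mul _) ?_
    filter_upwards [ae_restrict_of_ae_restrict_of_subset (Icc_subset_Ici_self (a := T) (b := 0)) hI.loop]
      with t ht
    rw [ht.1, ht.2.1]
    exact hB (g t) (e t) (x t)
  rw [intervalIntegral.integral_const_mul, intervalIntegral.integral_add hF hge] at hout
  refine hout.trans ?_
  rw [mul_assoc]
  refine mul_le_mul_of_nonneg_left ?_ hB0.le
  have h5 : ∫ t in (0 : ℝ)..T, ‖errGrad ψ z (x t)‖ ^ 2 ≤
      C / k * ∫ t in (0 : ℝ)..T, (‖g t‖ ^ 2 + ‖e t‖ ^ 2) := by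
    rw [div_mul_eq_mul_div, le_div_iff₀ hk0]
    linarith
  linarith

include hη hμf hL₁ hμc hL₂ hf hψ in
theorem isStable_md : IsStable (mdOperator d η μf μc) (mdNonlinearity f ψ μf μc y z) :=
  ⟨{ causal_G := isCausal_mdOperator
     causal_Δ := isCausal_mdNonlinearity hμf hL₁ hμc hL₂ hf hψ
     exists_solution := fun _ he _ hg => exists_interconnected hη hμf hL₁ hμc hL₂ hf hψ he hg
     causal_inverse := fun _ hT _ he _ he' _ hg _ hg' _ _ _ _ hI hI' =>
      agreeUpTo_of_interconnected hη hμf hL₁ hμc hL₂ hf hψ hT he he' hg hg' hI hI' },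
    exists_gain hη hμf hL₁ hμc hL₂ hf hψ⟩

/-- The signals of a stable interconnection are in `L₂` for inputs in `L₂`. -/
theorem IsStable.mem_L2 {E F : Type*} [NormedAddCommGroup E] [NormedAddCommGroup F]
    {G : (ℝ → F) → (ℝ → E)} {Δ : (ℝ → E) → (ℝ → F)} (hs : IsStable G Δ) {e : ℝ → F} {g : ℝ → E}
    (he : e ∈ L2 F) (hg : g ∈ L2 E) {v : ℝ → E} {w : ℝ → F} (hI : Interconnected G Δ e g v w) :
    v ∈ L2 E ∧ w ∈ L2 F := by
  obtain ⟨-, c, hc, hgain⟩ := hs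
  have hg2 := L2.mem_L2e hg
  have he2 := L2.mem_L2e he
  set C := c * ((∫ t in Ici 0, ‖g t‖ ^ 2) + ∫ t in Ici 0, ‖e t‖ ^ 2)
  have hb : ∀ T, 0 ≤ T →
      (∫ t in (0 : ℝ)..T, ‖v t‖ ^ 2) + ∫ t in (0 : ℝ)..T, ‖w t‖ ^ 2 ≤ C := fun T hT => by
    have h1 := hgain e he2 g hg2 v w hI T hT
    rw [intervalIntegral.integral_add (L2e.intervalIntegrable_norm_sq hI.mem_v hT)
      (L2e.intervalIntegrable_norm_sq hI.mem_w hT), intervalIntegral.integral_add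
      (L2e.intervalIntegrable_norm_sq hg2 hT) (L2e.intervalIntegrable_norm_sq he2 hT)] at h1
    exact h1.trans (mul_le_mul_of_nonneg_left
      (add_le_add (L2.integral_norm_sq_le hg hT) (L2.integral_norm_sq_le he hT)) hc.le)
  exact ⟨L2e.mem_L2 (C := C) hI.mem_v fun T hT => by
      have := intervalIntegral.integral_nonneg (f := fun t => ‖w t‖ ^ 2) (μ := volume) hT
        fun _ _ => by positivity
      linarith [hb T hT],
    L2e.mem_L2 (C := C) hI.mem_w fun T hT => by
      have := intervalIntegral.integral_nonneg (f := fun t => ‖v t‖ ^ 2) (μ := volume) hT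
        fun _ _ => by positivity
      linarith [hb T hT]⟩

end Stability

/-! ### Existence and convergence of the flow -/

section Trajectories

variable {d : ℕ} {η μf L₁ μc L₂ : ℝ} {f ψ : Vec d → ℝ}

theorem exists_trajectory (hη : 0 < η) (hμf : 0 < μf) (hL₁ : 0 < L₁) (hμc : 0 < μc)
    (hL₂ : 0 < L₂) (hf : f ∈ classS μf L₁) (hψ : ψ ∈ classS μc L₂) (z₀ : Vec d) :
    ∃ z : ℝ → Vec d, IsMDTrajectory η f ψ z ∧ z 0 = z₀ := by
  -- The flow is shifted by `z₀`, because the integral equation produces solutions that start at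
  -- zero.
  let Φ : Vec d → Vec d := fun x => -η • gradient f (gradient ψ (z₀ + x))
  have hlip : ∀ x y, ‖Φ x - Φ y‖ ≤ η * L₁ * L₂ * ‖x - y‖ := fun x y => by
    simp only [Φ]
    rw [← smul_sub, norm_smul, norm_neg, Real.norm_of_nonneg hη.le, mul_assoc, mul_assoc]
    refine mul_le_mul_of_nonneg_left ((classS.norm_gradient_sub_le hf hμf.le hL₁ _ _).trans
      (mul_le_mul_of_nonneg_left ?_ hL₁.le)) hη.le
    simpa using classS.norm_gradient_sub_le hψ hμc.le hL₂ (z₀ + x) (z₀ + y)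
  have hc : Continuous Φ := (LipschitzWith.of_dist_le' fun x y => by
    simpa only [dist_eq_norm] using hlip x y).continuous
  obtain ⟨u, huc, hu⟩ := exists_integral_eq (Φ := fun _ => Φ) (K := η * L₁ * L₂) (by positivity)
    (fun u hu T _ => (hc.comp hu).intervalIntegrable 0 T) (fun _ => hlip)
  refine ⟨fun t => z₀ + u t, fun t ht => ?_, by simp [hu 0 le_rfl]⟩
  have h1 : HasDerivAt (fun t => z₀ + ∫ s in (0 : ℝ)..t, Φ (u s)) (Φ (u t)) t :=
    (intervalIntegral.integral_hasDerivAt_right ((hc.comp huc).intervalIntegrable 0 t)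
      ((hc.comp huc).stronglyMeasurableAtFilter _ _) (hc.comp huc).continuousAt).const_add z₀
  exact h1.hasDerivWithinAt.congr (fun s hs => by rw [hu s hs]) (by rw [hu t ht])

theorem tendsto_trajectory (hη : 0 < η) (hμf : 0 < μf) (hμc : 0 < μc)
    (hL₂ : 0 < L₂) (hf : f ∈ classS μf L₁) (hψ : ψ ∈ classS μc L₂) {xopt zopt : Vec d}
    (hx : gradient f xopt = 0) (hz : gradient ψ zopt = xopt) {z : ℝ → Vec d}
    (h : IsMDTrajectory η f ψ z) : Tendsto (fun t => gradient ψ (z t)) atTop (𝓝 xopt) := by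
  let V : ℝ → ℝ := fun t => bregman ψ zopt (z t - zopt)
  let F : ℝ → Vec d := fun t => errGrad ψ zopt (z t - zopt)
  have hF : ∀ t, F t = gradient ψ (z t) - xopt := fun t => by simp [F, errGrad, hz]
  have hV : ∀ t, 0 ≤ t → HasDerivWithinAt V
      (inner ℝ (F t) (-η • gradient f (gradient ψ (z t)))) (Ici 0) t := fun t ht => by
    have := (hasGradientAt_bregman hψ zopt (z t - zopt)).hasFDerivAt.comp_hasDerivWithinAt t
      ((h t ht).sub_const zopt)
    simpa [Function.comp_def] using this
  have hdiss : ∀ t, inner ℝ (F t) (-η • gradient f (gradient ψ (z t)))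
      ≤ -(η * μf * μc) * V t := fun t => by
    have h1 := le_inner_errGrad hf xopt (F t)
    have h2 : errGrad f xopt (F t) = gradient f (gradient ψ (z t)) := by
      simp [errGrad, hx, hF]
    rw [h2, real_inner_comm] at h1
    have h3 := bregman_le_norm_errGrad_sq hψ hμc zopt (z t - zopt)
    rw [inner_smul_right]
    have h4 := mul_le_mul_of_nonneg_left h1 hη.le
    have h5 := mul_le_mul_of_nonneg_left h3 (mul_pos hη hμf).le
    simp only [V, F] at *
    linarith
  set k := η * μf * μc with hk
  have hk0 : 0 < k := by positivity
  -- Integrating factor for the differential inequality `V' ≤ -k V`.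
  have hW : ∀ t, 0 ≤ t → HasDerivWithinAt (fun t => Real.exp (k * t) * V t)
      (Real.exp (k * t) * (k * 1) * V t + Real.exp (k * t) *
        inner ℝ (F t) (-η • gradient f (gradient ψ (z t)))) (Ici 0) t := fun t ht =>
    ((hasDerivAt_id t).const_mul k).exp.hasDerivWithinAt.mul (hV t ht)
  have hanti : AntitoneOn (fun t => Real.exp (k * t) * V t) (Ici 0) := by
    refine antitoneOn_of_hasDerivWithinAt_nonpos (convex_Ici 0)
      (fun t ht => (hW t ht).continuousWithinAt)
      (fun t ht => (hW t (interior_subset ht)).mono interior_subset) fun t _ => ?_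
    have := mul_le_mul_of_nonneg_left (hdiss t) (Real.exp_pos (k * t)).le
    linarith
  have hdecay : ∀ t, 0 ≤ t → V t ≤ Real.exp (-(k * t)) * V 0 := fun t ht => by
    have := hanti (mem_Ici.2 le_rfl) (mem_Ici.2 ht) ht
    simp only [mul_zero, Real.exp_zero, one_mul] at this
    rw [Real.exp_neg, inv_mul_eq_div, le_div_iff₀ (Real.exp_pos _)]
    linarith
  have hlim : Tendsto (fun t => 2 * L₂ * (Real.exp (-(k * t)) * V 0)) atTop (𝓝 0) := by
    have h1 : Tendsto (fun t : ℝ => Real.exp (-(k * t))) atTop (𝓝 0) :=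
      Real.tendsto_exp_neg_atTop_nhds_zero.comp (tendsto_id.const_mul_atTop hk0)
    simpa using (h1.mul_const (V 0)).const_mul (2 * L₂)
  have hF2 : Tendsto (fun t => ‖F t‖ ^ 2) atTop (𝓝 0) := by
    refine squeeze_zero' (Eventually.of_forall fun t => by positivity) ?_ hlim
    filter_upwards [eventually_ge_atTop 0] with t ht
    exact (norm_errGrad_sq_le hψ hμc hL₂ zopt (z t - zopt)).trans
      (mul_le_mul_of_nonneg_left (hdecay t ht) (by positivity))
  have hF1 : Tendsto (fun t => ‖F t‖) atTop (𝓝 0) := by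
    simpa [Real.sqrt_sq] using hF2.sqrt
  rw [tendsto_iff_norm_sub_tendsto_zero]
  simpa only [hF] using hF1

end Trajectories

end MirrorDescent

/-! ### The main theorem -/

open MirrorDescent in
theorem theorem2 (d : ℕ) (η μf Lf μφ Lφ : ℝ) (hη : 0 < η)
    (hμf : 0 < μf) (hLf : μf ≤ Lf) (hμφ : 0 < μφ) (hLφ : μφ ≤ Lφ)
    (f φ : Vec d → ℝ) (hf : f ∈ classS μf Lf) (hφ : φ ∈ classS μφ Lφ) :
    ∃ xopt zopt : Vec d,
      -- `xopt` is the unique minimizer of `f`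
      (∀ x : Vec d, (∀ y : Vec d, f x ≤ f y) ↔ x = xopt) ∧
      -- `zopt` is the unique equilibrium of the flow, and it corresponds to `xopt`
      (∀ z : Vec d, gradient f (gradient (conjugate φ) z) = 0 ↔ z = zopt) ∧
      gradient (conjugate φ) zopt = xopt ∧
      -- the interconnection is stable, and its signals are in `L₂` for inputs in `L₂`
      IsStable (mdOperator d η μf Lφ⁻¹) (mdNonlinearity f (conjugate φ) μf Lφ⁻¹ xopt zopt) ∧
      (∀ e ∈ L2 (Vec2 d), ∀ g ∈ L2 (Vec2 d), ∀ v w : ℝ → Vec2 d,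
        Interconnected (mdOperator d η μf Lφ⁻¹)
          (mdNonlinearity f (conjugate φ) μf Lφ⁻¹ xopt zopt) e g v w →
        v ∈ L2 (Vec2 d) ∧ w ∈ L2 (Vec2 d)) ∧
      -- every initial condition has a trajectory, and along every trajectory `x` converges
      (∀ z₀ : Vec d, ∃ z : ℝ → Vec d, IsMDTrajectory η f (conjugate φ) z ∧ z 0 = z₀) ∧
      (∀ z : ℝ → Vec d, IsMDTrajectory η f (conjugate φ) z →
        Tendsto (fun t => gradient (conjugate φ) (z t)) atTop (𝓝 xopt)) := by
  have hLf0 : 0 < Lf := hμf.trans_le hLf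
  have hLφ0 : 0 < Lφ := hμφ.trans_le hLφ
  have hψ := classS.conjugate_mem hφ hμφ hLφ0
  obtain ⟨xopt, hx⟩ := exists_gradient_eq hμf (classS.hasGradientAt hf)
    (fun x y => (hf.2 x y).1) 0
  have hgrad : ∀ x, gradient f x = 0 ↔ x = xopt := fun x =>
    ⟨fun h => gradient_injective hμf (fun x y => (hf.2 x y).1) (h.trans hx.symm),
      fun h => h ▸ hx⟩
  -- The gradient of the conjugate inverts `∇φ`, so the equilibrium has to be `gradient φ xopt`.
  have hz := classS.gradient_conjugate hφ hμφ xopt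
  have hstable := isStable_md (y := xopt) (z := gradient φ xopt) hη hμf hLf0 (inv_pos.2 hLφ0)
    (inv_pos.2 hμφ) hf hψ
  refine ⟨xopt, gradient φ xopt, fun x => (classS.isMinimizer_iff hf hμf.le x).trans (hgrad x),
    fun z => (hgrad _).trans ⟨fun h => ?_, fun h => ?_⟩, hz, hstable,
    fun e he g hg v w hI => hstable.mem_L2 he hg hI,
    exists_trajectory hη hμf hLf0 (inv_pos.2 hLφ0) (inv_pos.2 hμφ) hf hψ,
    fun z h => tendsto_trajectory hη hμf (inv_pos.2 hLφ0) (inv_pos.2 hμφ) hf hψ hx hz h⟩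
  · rw [← h, classS.gradient_gradient_conjugate hφ hμφ]
  · rw [h, hz]
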